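/- **Conventions.** For an additive category $\mathcal B$, $\operatorname{mod}\mathcal B$ is the category of finitely presented contravariant additive functors $\mathcal B\to\mathrm{Ab}$ (cokernels of morphisms between representable functors $\operatorname{Hom}_{\mathcal B}(-,X)$), and $\operatorname{gldim}\operatorname{mod}\mathcal B\in\mathbb N\cup\{\infty\}$ is the supremum of the lengths of shortest projective resolutions of its objects. A two-sided noetherian ring $R$ is *Iwanaga–Gorenstein* if $R$ has finite injective dimension both as a left and as a right $R$-module; these two dimensions then coincide, and the common value is the *virtual dimension* $\operatorname{virdim}R$. For such $R$, $\operatorname{GP}(R)$ is the category of finitely generated right $R$-modules $M$ with $\operatorname{Ext}^i_R(M,R)=0$ for all $i>0$, with the exact structure given by the short exact sequences of modules with terms in $\operatorname{GP}(R)$. For an object $P$ of an additive category, $\operatorname{add}P$ denotes the direct summands of finite direct sums of copies of $P$. An exact category (in the sense of Quillen) is *Frobenius* if it has enough projectives and enough injectives and these coincide. An *exact equivalence* of exact categories is an equivalence which is exact together with its quasi-inverse, i.e. a sequence is a conflation if and only if its image is. **Proposition.** Let $\mathcal E$ be an exact category and let $P\in\mathcal E$. The following are equivalent. (a) The following conditions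 hold: (i) $\operatorname{proj}\mathcal E=\operatorname{add}P$, where $\operatorname{proj}\mathcal E$ is the class of projective objects of $\mathcal E$, and $\operatorname{End}_{\mathcal E}(P)$ is two-sided noetherian; (ii) $\mathcal E$ is idempotent complete; (iii) $\mathcal E$ is Frobenius; (iv) $\mathcal E$ has weak kernels and weak cokernels; (v) $\operatorname{gldim}\operatorname{mod}\mathcal E<\infty$ and $\operatorname{gldim}\operatorname{mod}\mathcal E^{\mathrm{op}}<\infty$. (b) Set $R=\operatorname{End}_{\mathcal E}(P)$. The functor $\operatorname{Hom}_{\mathcal E}(P,-)$ takes values in $\operatorname{GP}(R)$ and is an exact equivalence $\mathcal E\to\operatorname{GP}(R)$, and $R$ is Iwanaga–Gorenstein with $\operatorname{virdim}R\le\operatorname{gldim}\operatorname{mod}\mathcal E$. -/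

import Mathlib

open CategoryTheory CategoryTheory.Limits

universe v u

namespace Frob

/-! ### Exact categories -/

section Exact

variable {E : Type u} [Category.{v} E] [Preadditive E]

/-- The first morphisms of the short complexes in a class `c`. -/
def IsInflation (c : ShortComplex E → Prop) ⦃X Y : E⦄ (f : X ⟶ Y) : Prop :=
  ∃ (Z : E) (g : Y ⟶ Z) (w : f ≫ g = 0), c (ShortComplex.mk f g w)

/-- The second morphisms of the short complexes in a class `c`. -/
def IsDeflation (c : ShortComplex E → Prop) ⦃Y Z : E⦄ (g : Y ⟶ Z) : Prop :=
  ∃ (X : E) (f : X ⟶ Y) (w : f ≫ g = 0), c (ShortComplex.mk f g w)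

/-- An exact structure, in the sense of Quillen, on an additive category `E`: a class of
kernel-cokernel pairs `X ⟶ Y ⟶ Z`, closed under isomorphism, the *conflations*. The first morphism
of a conflation is called an *inflation*, the second one a *deflation*; identities are inflations
and deflations, both classes are closed under composition, inflations are stable under pushout
along arbitrary morphisms and deflations are stable under pullback along arbitrary morphisms. -/
structure ExactStructure (E : Type u) [Category.{v} E] [Preadditive E]
    [HasFiniteBiproducts E] where
  /-- the class of conflations -/
  conflation : ShortComplex E → Prop
  conflation_of_iso : ∀ {S T : ShortComplex E}, (S ≅ T) → conflation S → conflation T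
  isKernel : ∀ {S : ShortComplex E}, conflation S →
    Nonempty (IsLimit (KernelFork.ofι S.f S.zero))
  isCokernel : ∀ {S : ShortComplex E}, conflation S →
    Nonempty (IsColimit (CokernelCofork.ofπ S.g S.zero))
  inflation_id : ∀ X : E, IsInflation conflation (𝟙 X)
  deflation_id : ∀ X : E, IsDeflation conflation (𝟙 X)
  inflation_comp : ∀ {X Y Z : E} (f : X ⟶ Y) (g : Y ⟶ Z),
    IsInflation conflation f → IsInflation conflation g → IsInflation conflation (f ≫ g)
  deflation_comp : ∀ {X Y Z : E} (f : X ⟶ Y) (g : Y ⟶ Z),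
    IsDeflation conflation f → IsDeflation conflation g → IsDeflation conflation (f ≫ g)
  exists_pushout : ∀ {X Y X' : E} (i : X ⟶ Y) (a : X ⟶ X'), IsInflation conflation i →
    ∃ (Y' : E) (b : Y ⟶ Y') (j : X' ⟶ Y'), IsPushout i a b j ∧ IsInflation conflation j
  exists_pullback : ∀ {Y Z Z' : E} (p : Y ⟶ Z) (a : Z' ⟶ Z), IsDeflation conflation p →
    ∃ (Y' : E) (b : Y' ⟶ Y) (q : Y' ⟶ Z'), IsPullback b q p a ∧ IsDeflation conflation q

variable [HasFiniteBiproducts E]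

/-- `X` is projective: morphisms out of `X` lift along all deflations. -/
def ExactStructure.IsProj (e : ExactStructure E) (X : E) : Prop :=
  ∀ ⦃Y Z : E⦄ (p : Y ⟶ Z), IsDeflation e.conflation p → ∀ f : X ⟶ Z, ∃ g : X ⟶ Y, g ≫ p = f

/-- `X` is injective: morphisms into `X` extend along all inflations. -/
def ExactStructure.IsInj (e : ExactStructure E) (X : E) : Prop :=
  ∀ ⦃Y Z : E⦄ (i : Y ⟶ Z), IsInflation e.conflation i → ∀ f : Y ⟶ X, ∃ g : Z ⟶ X, i ≫ g = f

/-- A Frobenius category: an exact category with enough projectives and enough injectives in which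
the projective and the injective objects coincide. -/
structure ExactStructure.IsFrobenius (e : ExactStructure E) : Prop where
  enoughProj : ∀ X : E, ∃ (Q : E) (p : Q ⟶ X), e.IsProj Q ∧ IsDeflation e.conflation p
  enoughInj : ∀ X : E, ∃ (I : E) (i : X ⟶ I), e.IsInj I ∧ IsInflation e.conflation i
  proj_iff_inj : ∀ X : E, e.IsProj X ↔ e.IsInj X

attribute [local instance] hasBinaryBiproducts_of_finite_biproducts

/-- `X` lies in `add P`: it is a direct summand of a finite direct sum of copies of `P`. -/
def IsInAdd (P X : E) : Prop :=
  ∃ (n : ℕ) (Y : E), Nonempty ((X ⊞ Y) ≅ (⨁ fun _ : Fin n => P))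

end Exact

/-- Every morphism has a weak cokernel. -/
def HasWeakCokernels (E : Type u) [Category.{v} E] [Preadditive E] : Prop :=
  ∀ ⦃X Y : E⦄ (f : X ⟶ Y), ∃ (Z : E) (c : Y ⟶ Z), f ≫ c = 0 ∧
    ∀ ⦃W : E⦄ (g : Y ⟶ W), f ≫ g = 0 → ∃ h : Z ⟶ W, c ≫ h = g

/-! ### Finitely presented functors -/

section FinPres

variable (E : Type u) [Category.{v} E] [Preadditive E]

/-- A contravariant functor from `E` to abelian groups is finitely presented if it is the cokernel
of a morphism `Hom(-, X) ⟶ Hom(-, Y)` between representable functors. Such a functor is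
automatically additive. -/
def isFinPres : ObjectProperty (Eᵒᵖ ⥤ AddCommGrpCat.{v}) := fun F =>
  ∃ (X Y : E) (f : X ⟶ Y), Nonempty (F ≅ cokernel (preadditiveYoneda.map f))

/-- The category `mod E` of finitely presented contravariant additive functors from `E` to abelian
groups. -/
abbrev FunMod := (isFinPres E).FullSubcategory

variable {E}

/-- `F` has a projective resolution in `mod E` of length at most `n`, where exactness is
exactness of functors, i.e. at each object of `E`. -/
def FunMod.HasProjDimLE : ℕ → FunMod E → Prop
  | 0, F => Projective F
  | n + 1, F => ∃ S : ShortComplex (FunMod E), (S.map (isFinPres E).ι).ShortExact ∧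
      Projective S.X₂ ∧ Nonempty (S.X₃ ≅ F) ∧ FunMod.HasProjDimLE n S.X₁

/-- The projective dimension of `F` in `mod E` (`⊤` if there is no finite resolution). -/
noncomputable def FunMod.projDim (F : FunMod E) : ℕ∞ :=
  ⨅ (n : ℕ) (_ : FunMod.HasProjDimLE n F), (n : ℕ∞)

variable (E)

/-- The global dimension of `mod E`. -/
noncomputable def gldimMod : ℕ∞ := ⨆ F : FunMod E, F.projDim

end FinPres

/-! ### Iwanaga-Gorenstein rings; right `R`-modules are left `Rᵐᵒᵖ`-modules -/

section Gorenstein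

variable (R : Type v) [Ring R]

/-- `R` is two-sided noetherian. -/
def IsTwoSidedNoetherian : Prop := IsNoetherianRing R ∧ IsNoetherianRing Rᵐᵒᵖ

/-- `R` as a right module over itself. -/
abbrev rightRegular : ModuleCat.{v} Rᵐᵒᵖ := ModuleCat.of Rᵐᵒᵖ R

/-- A two-sided noetherian ring of finite injective dimension on both sides. -/
structure IsIwanagaGorenstein : Prop where
  noetherian : IsTwoSidedNoetherian R
  injdim_left : injectiveDimension (ModuleCat.of R R) < ⊤
  injdim_right : injectiveDimension (rightRegular R) < ⊤

/-- The virtual dimension of an Iwanaga-Gorenstein ring: the injective dimension of `R` as a right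
module (for such a ring it agrees with that of `R` as a left module; it is `⊥` for the zero
ring). -/
noncomputable def virdim : WithBot ℕ∞ := injectiveDimension (rightRegular R)

/-- A right `R`-module `M` is Gorenstein projective if it is finitely generated and
`Ext^i(M, R) = 0` for all `i > 0`. -/
def isGP : ObjectProperty (ModuleCat.{v} Rᵐᵒᵖ) := fun M =>
  Module.Finite Rᵐᵒᵖ M ∧ ∀ i : ℕ, 0 < i → Subsingleton (Abelian.Ext M (rightRegular R) i)

/-- The category `GP(R)` of Gorenstein projective right `R`-modules. -/
abbrev GP := (isGP R).FullSubcategory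

variable {R}

/-- The conflations of `GP(R)`: short exact sequences of modules with terms in `GP(R)`. -/
def GP.conflation (S : ShortComplex (GP R)) : Prop := (S.map (isGP R).ι).ShortExact

end Gorenstein

section Hom

variable {E : Type u} [Category.{v} E] [Preadditive E]

/-- The functor `Hom(P, -) : E ⥤ GP(End P)`, if it takes values in `GP(End P)`. -/
def homGP (P : E) (h : ∀ X, isGP (End P) ((preadditiveCoyonedaObj P).obj X)) : E ⥤ GP (End P) :=
  (isGP (End P)).lift (preadditiveCoyonedaObj P) h

instance (P : E) (h : ∀ X, isGP (End P) ((preadditiveCoyonedaObj P).obj X)) :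
    (homGP P h).Additive :=
  inferInstanceAs ((isGP (End P)).lift (preadditiveCoyonedaObj P) h).Additive

/-- An exact equivalence between an exact category and `GP(R)`: an equivalence of categories
which identifies the conflations on both sides, so that it and its quasi-inverse are exact. -/
structure IsExactEquivalence [HasFiniteBiproducts E] {R : Type v} [Ring R]
    (e : ExactStructure E) (Φ : E ⥤ GP R) [Φ.Additive] : Prop where
  isEquivalence : Φ.IsEquivalence
  conflation_iff : ∀ S : ShortComplex E, e.conflation S ↔ GP.conflation (S.map Φ)

end Hom

section Conditions

variable {E : Type u} [Category.{v} E] [Preadditive E] [HasFiniteBiproducts E]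

/-- Conditions (i)-(v) on an exact category and an object `P`. -/
structure SatisfiesConditions (e : ExactStructure E) (P : E) : Prop where
  proj_eq_add : ∀ X : E, e.IsProj X ↔ IsInAdd P X
  noetherian : IsTwoSidedNoetherian (End P)
  idempotentComplete : IsIdempotentComplete E
  frobenius : e.IsFrobenius
  weakKernels : HasWeakKernels E
  weakCokernels : HasWeakCokernels E
  gldim_lt : gldimMod E < ⊤
  gldim_op_lt : gldimMod Eᵒᵖ < ⊤

end Conditions

end Frob

/-! Both implications use one abstract setting: a functor `G` to `S`-modules represented by `P`,
with `G.obj P` free on one element. It covers `Hom(P, -)` on `E` over `(End P)ᵐᵒᵖ` and `Hom(-, P)`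
on `Eᵒᵖ` over `End P`, so left modules are handled by passing to the opposite exact structure.

From (a) to (b): `P` is projective and injective, and every object is a quotient and a subobject of
one in `add P`. Hence `G` is fully faithful, preserves and reflects conflations, and its values have
no higher Ext to `G P`. A finitely generated module `M` is the value at `P` of a finitely presented
functor. Projectives of `mod E` are representable, so evaluating a projective resolution at `P`
resolves `M` by modules `G X` in at most gldim steps (`Represents.hasResLE`). Dimension shifting and
Baer's criterion bound the injective dimension of `G P`. If `M` is Gorenstein projective, the
resolution collapses from its far end by `Represents.exists_equiv_of_shortExact`, so `M` is itself
some `G X`.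

From (b) to (a): finite injective dimension on the other side makes duality into `R` preserve
Gorenstein projectives, which are then reflexive (`extZero_dual`, `exists_eq_eval`,
`eq_zero_of_dual`). Generators of the dual embed each of them in a power of `R` with Gorenstein
projective cokernel, which gives enough injectives. The embeddings also yield Gorenstein projective
approximations of finitely generated modules (`exists_approximation`), hence weak kernels and, for a
functor presented by `f`, a resolution of length `d + 2` with second syzygy `Hom(G -, ker (G f))`.
Reflexivity moves all this to `Eᵒᵖ` (`exists_yoneda_equiv`). -/

namespace Frob

/-! ### Ext vanishing against a fixed module, and injective dimension -/

section ExtVanishing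

variable (S : Type v) [Ring S] (B : Type v) [AddCommGroup B] [Module S B]

/-- `Ext^i(M, B) = 0` for all `i > n`. -/
def ExtZero (n : ℕ) (M : Type v) [AddCommGroup M] [Module S M] : Prop :=
  ∀ i : ℕ, n < i → Subsingleton (Abelian.Ext (ModuleCat.of S M) (ModuleCat.of S B) i)

variable {S B}

theorem ExtZero.mono {n m : ℕ} (h : n ≤ m) {M : Type v} [AddCommGroup M] [Module S M]
    (hM : ExtZero S B n M) : ExtZero S B m M := fun i hi => hM i (by omega)

variable {K Q X : Type v} [AddCommGroup K] [AddCommGroup Q] [AddCommGroup X]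
  [Module S K] [Module S Q] [Module S X]

theorem shortExact_of {f : K →ₗ[S] Q} {g : Q →ₗ[S] X} (hf : Function.Injective f)
    (hg : Function.Surjective g) (h : Function.Exact f g) :
    (ShortComplex.mk (ModuleCat.ofHom f) (ModuleCat.ofHom g)
      (by ext x; exact h.apply_apply_eq_zero x)).ShortExact where
  exact := by
    rw [ShortComplex.ShortExact.moduleCat_exact_iff_function_exact]
    exact h
  mono_f := (ModuleCat.mono_iff_injective _).2 hf
  epi_g := (ModuleCat.epi_iff_surjective _).2 hg

theorem ExtZero.of_retract {n : ℕ} (hQ : ExtZero S B n Q) (i : X →ₗ[S] Q) (p : Q →ₗ[S] X)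
    (h : ∀ x, p (i x) = x) : ExtZero S B n X := fun k hk => by
  have := hQ k hk
  refine ⟨fun a b => ?_⟩
  have key : ∀ x : Abelian.Ext (ModuleCat.of S X) (ModuleCat.of S B) k,
      x = (Abelian.Ext.mk₀ (ModuleCat.ofHom i)).comp
        ((Abelian.Ext.mk₀ (ModuleCat.ofHom p)).comp x (zero_add k)) (zero_add k) := fun x => by
    rw [Abelian.Ext.mk₀_comp_mk₀_assoc, ← ModuleCat.ofHom_comp,
      show p ∘ₗ i = LinearMap.id from LinearMap.ext h]
    exact (Abelian.Ext.mk₀_id_comp x).symm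
  rw [key a, key b]
  congr 1
  exact Subsingleton.elim _ _

theorem ExtZero.of_equiv {n : ℕ} (hQ : ExtZero S B n Q) (e : Q ≃ₗ[S] X) : ExtZero S B n X :=
  hQ.of_retract e.symm.toLinearMap e.toLinearMap (by simp)

theorem extZero_of_projective [Module.Projective S X] : ExtZero S B 0 X := fun k hk => by
  have : Projective (ModuleCat.of S X) := (IsProjective.iff_projective X).1 inferInstance
  obtain ⟨k, rfl⟩ : ∃ j, k = j + 1 := ⟨k - 1, by omega⟩
  exact subsingleton_of_forall_eq 0 fun x => x.eq_zero_of_projective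

theorem ExtZero.shift {n : ℕ} (hQ : ExtZero S B 0 Q) {f : K →ₗ[S] Q} {g : Q →ₗ[S] X}
    (hf : Function.Injective f) (hg : Function.Surjective g) (h : Function.Exact f g) :
    ExtZero S B (n + 1) X ↔ ExtZero S B n K := by
  have hS := shortExact_of hf hg h
  constructor
  · intro hX i hi
    refine subsingleton_of_forall_eq 0 fun x => ?_
    obtain ⟨y, hy⟩ := Abelian.Ext.contravariant_sequence_exact₁ hS _ x (add_comm 1 i)
      ((hX (i + 1) (by omega)).elim _ _)
    rw [← hy, (hQ i (by omega)).elim y 0, Abelian.Ext.comp_zero]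
  · intro hK i hi
    obtain ⟨i, rfl⟩ : ∃ j, i = j + 1 := ⟨i - 1, by omega⟩
    refine subsingleton_of_forall_eq 0 fun x => ?_
    obtain ⟨y, hy⟩ := Abelian.Ext.contravariant_sequence_exact₃ hS _ x
      ((hQ (i + 1) (by omega)).elim _ _) (add_comm 1 i)
    rw [← hy, (hK i (by omega)).elim y 0, Abelian.Ext.comp_zero]

theorem ExtZero.extend (hX : ExtZero S B 0 X) {f : K →ₗ[S] Q} {g : Q →ₗ[S] X}
    (hf : Function.Injective f) (hg : Function.Surjective g) (h : Function.Exact f g)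
    (φ : K →ₗ[S] B) : ∃ ψ : Q →ₗ[S] B, ψ ∘ₗ f = φ := by
  have hS := shortExact_of hf hg h
  obtain ⟨y, hy⟩ := Abelian.Ext.contravariant_sequence_exact₁ hS (ModuleCat.of S B)
    (Abelian.Ext.mk₀ (ModuleCat.ofHom φ)) (add_zero 1) ((hX 1 one_pos).elim _ _)
  obtain ⟨ψ, rfl⟩ := Abelian.Ext.homEquiv₀.symm.surjective y
  refine ⟨ψ.hom, ?_⟩
  have : ModuleCat.ofHom f ≫ ψ = ModuleCat.ofHom φ :=
    Abelian.Ext.homEquiv₀.symm.injective (by simpa using hy)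
  exact congrArg ModuleCat.Hom.hom this

theorem subsingleton_ext_succ (hQ : ExtZero S B 0 Q) {f : K →ₗ[S] Q} {g : Q →ₗ[S] X}
    (hf : Function.Injective f) (hg : Function.Surjective g) (h : Function.Exact f g) {i : ℕ}
    (hK : Subsingleton (Abelian.Ext (ModuleCat.of S K) (ModuleCat.of S B) i)) :
    Subsingleton (Abelian.Ext (ModuleCat.of S X) (ModuleCat.of S B) (i + 1)) := by
  have hS := shortExact_of hf hg h
  refine subsingleton_of_forall_eq 0 fun x => ?_
  obtain ⟨y, hy⟩ := Abelian.Ext.contravariant_sequence_exact₃ hS _ x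
    ((hQ (i + 1) (by omega)).elim _ _) (add_comm 1 i)
  rw [← hy, hK.elim y 0, Abelian.Ext.comp_zero]

theorem subsingleton_ext_one (hQ : ExtZero S B 0 Q) {f : K →ₗ[S] Q} {g : Q →ₗ[S] X}
    (hf : Function.Injective f) (hg : Function.Surjective g) (h : Function.Exact f g)
    (hext : ∀ φ : K →ₗ[S] B, ∃ ψ : Q →ₗ[S] B, ψ ∘ₗ f = φ) :
    Subsingleton (Abelian.Ext (ModuleCat.of S X) (ModuleCat.of S B) 1) := by
  have hS := shortExact_of hf hg h
  refine subsingleton_of_forall_eq 0 fun x => ?_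
  obtain ⟨y, hy⟩ := Abelian.Ext.contravariant_sequence_exact₃ hS _ x
    ((hQ 1 one_pos).elim _ _) (add_zero 1)
  rw [← hy]
  obtain ⟨φ, rfl⟩ := Abelian.Ext.homEquiv₀.symm.surjective y
  obtain ⟨ψ, hψ⟩ := hext φ.hom
  have : φ = ModuleCat.ofHom f ≫ ModuleCat.ofHom ψ := by
    ext x; exact (LinearMap.congr_fun hψ x).symm
  rw [this]
  simp only [Abelian.Ext.homEquiv₀_symm_apply, ← Abelian.Ext.mk₀_comp_mk₀]
  exact hS.extClass_comp_assoc _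

/-- Degree one is the obstruction to extending maps from `K` to `B`, which `hext` removes; higher
degrees shift to `K`. -/
theorem ExtZero.of_extend (hK : ExtZero S B 0 K) (hQ : ExtZero S B 0 Q)
    {f : K →ₗ[S] Q} {g : Q →ₗ[S] X}
    (hf : Function.Injective f) (hg : Function.Surjective g) (h : Function.Exact f g)
    (hext : ∀ φ : K →ₗ[S] B, ∃ ψ : Q →ₗ[S] B, ψ ∘ₗ f = φ) : ExtZero S B 0 X := by
  intro i hi
  obtain ⟨i, rfl⟩ : ∃ j, i = j + 1 := ⟨i - 1, by omega⟩
  rcases Nat.eq_zero_or_pos i with rfl | hi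
  · exact subsingleton_ext_one hQ hf hg h hext
  · exact subsingleton_ext_succ hQ hf hg h (hK i hi)

/-- Two cokernels of the same map are isomorphic. -/
theorem nonempty_equiv_of_exact {X' : Type v} [AddCommGroup X'] [Module S X'] {f : K →ₗ[S] Q}
    {g : Q →ₗ[S] X} {g' : Q →ₗ[S] X'} (hg : Function.Surjective g) (h : Function.Exact f g)
    (hg' : Function.Surjective g') (h' : Function.Exact f g') : Nonempty (X ≃ₗ[S] X') := by
  have hk : LinearMap.ker g = LinearMap.ker g' := by
    rw [h.linearMap_ker_eq, h'.linearMap_ker_eq]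
  exact ⟨(g.quotKerEquivOfSurjective hg).symm ≪≫ₗ Submodule.quotEquivOfEq _ _ hk ≪≫ₗ
    g'.quotKerEquivOfSurjective hg'⟩

variable (S B) in
theorem extZero_of_injectiveDimension_lt_top
    (h : injectiveDimension (ModuleCat.of S B) < ⊤) :
    ∃ d : ℕ, ∀ (M : Type v) [AddCommGroup M] [Module S M], ExtZero S B d M := by
  obtain ⟨d, hd⟩ : ∃ d : ℕ, injectiveDimension (ModuleCat.of S B) ≤ d := by
    generalize injectiveDimension (ModuleCat.of S B) = a at h
    cases a with
    | bot => exact ⟨0, bot_le⟩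
    | coe a =>
      cases a with
      | top => exact absurd h (lt_irrefl _)
      | coe a => exact ⟨a, le_rfl⟩
  have := (injectiveDimension_le_iff _ _).1 hd
  exact ⟨d, fun M _ _ i hi => HasInjectiveDimensionLT.subsingleton _ (d + 1) i hi _⟩

/-- For `d = 0` this is Baer's criterion. Otherwise `B` is embedded in an injective module, and
passing to the cokernel lowers the degree by one. -/
theorem hasInjectiveDimensionLE_of_extZero (d : ℕ) : ∀ (B : Type v) [AddCommGroup B] [Module S B],
    (∀ I : Ideal S, ExtZero S B d (S ⧸ I)) → HasInjectiveDimensionLE (ModuleCat.of S B) d := by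
  induction d with
  | zero =>
    intro B _ _ h
    have : Module.Baer S B := fun I φ => by
      obtain ⟨ψ, hψ⟩ := (h I).extend (f := I.subtype) (g := I.mkQ) I.subtype_injective
        I.mkQ_surjective (LinearMap.exact_subtype_mkQ I) φ
      exact ⟨ψ, fun x hx => LinearMap.congr_fun hψ ⟨x, hx⟩⟩
    have := this.injective
    have : Injective (ModuleCat.of S B) := Module.injective_object_of_injective_module S B
    infer_instance
  | succ d ih =>
    intro B _ _ h
    let J := Injective.under (ModuleCat.of S B)
    let ι : ModuleCat.of S B ⟶ J := Injective.ι _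
    have hι : Function.Injective ι.hom := (ModuleCat.mono_iff_injective ι).1 inferInstance
    have hS := shortExact_of (f := ι.hom) (g := ι.hom.range.mkQ) hι (Submodule.mkQ_surjective _)
      (LinearMap.exact_map_mkQ_range _)
    have hC := ih (J ⧸ ι.hom.range) fun I i hi => by
      refine subsingleton_of_forall_eq 0 fun x => ?_
      obtain ⟨y, rfl⟩ := Abelian.Ext.covariant_sequence_exact₃ _ hS x rfl
        ((h I (i + 1) (by omega)).elim _ _)
      have : y = 0 := by
        obtain ⟨i, rfl⟩ : ∃ j, i = j + 1 := ⟨i - 1, by omega⟩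
        have : Injective (ModuleCat.of S J) := inferInstanceAs (Injective J)
        exact Abelian.Ext.eq_zero_of_injective (I := ModuleCat.of S J) y
      rw [this, Abelian.Ext.zero_comp]
    exact (hS.hasInjectiveDimensionLT_X₃_iff d (inferInstanceAs (Injective J))).1 hC

end ExtVanishing

/-! ### Conflations and generators of Frobenius categories -/

section Conflations

variable {A : Type u} [Category.{v} A] [Preadditive A] [HasFiniteBiproducts A]
  {e : ExactStructure A}

theorem ExactStructure.exists_lift {T : ShortComplex A} (hT : e.conflation T) {W : A}
    (a : W ⟶ T.X₂) (h : a ≫ T.g = 0) : ∃ b : W ⟶ T.X₁, b ≫ T.f = a := by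
  obtain ⟨hl⟩ := e.isKernel hT
  exact ⟨hl.lift (KernelFork.ofι a h), hl.fac _ WalkingParallelPair.zero⟩

theorem ExactStructure.exists_desc {T : ShortComplex A} (hT : e.conflation T) {W : A}
    (a : T.X₂ ⟶ W) (h : T.f ≫ a = 0) : ∃ b : T.X₃ ⟶ W, T.g ≫ b = a := by
  obtain ⟨hl⟩ := e.isCokernel hT
  exact ⟨hl.desc (CokernelCofork.ofπ a h), hl.fac _ WalkingParallelPair.one⟩

theorem ExactStructure.mono_f {T : ShortComplex A} (hT : e.conflation T) : Mono T.f := by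
  obtain ⟨hl⟩ := e.isKernel hT
  exact ⟨fun a b h => Fork.IsLimit.hom_ext hl h⟩

theorem ExactStructure.epi_g {T : ShortComplex A} (hT : e.conflation T) : Epi T.g := by
  obtain ⟨hl⟩ := e.isCokernel hT
  exact ⟨fun a b h => Cofork.IsColimit.hom_ext hl h⟩

/-- The pushout of a conflation along a morphism out of its first term. -/
theorem ExactStructure.exists_pushout_conflation {T : ShortComplex A} (hT : e.conflation T)
    {Y : A} (a : T.X₁ ⟶ Y) :
    ∃ (W : A) (b : T.X₂ ⟶ W) (j : Y ⟶ W) (r : W ⟶ T.X₃) (w : j ≫ r = 0),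
      IsPushout T.f a b j ∧ b ≫ r = T.g ∧ e.conflation (ShortComplex.mk j r w) := by
  obtain ⟨W, b, j, hp, C, c, w, hc⟩ := e.exists_pushout T.f a ⟨_, _, T.zero, hT⟩
  -- The axiom only provides some cokernel `c` of `j`. The map `W ⟶ T.X₃` induced by the pushout is
  -- compared with it through `m` and `m'`.
  have hr : T.f ≫ T.g = a ≫ (0 : Y ⟶ T.X₃) := by simp
  obtain ⟨m, hm⟩ := e.exists_desc hT (b ≫ c) (by rw [hp.w_assoc, w, comp_zero])
  obtain ⟨m', hm'⟩ := e.exists_desc hc (hp.desc T.g 0 hr) (by simp)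
  simp only at hm'
  have h1 : hp.desc T.g 0 hr ≫ m = c := hp.hom_ext (by simp [hm]) (by simp [w])
  have := e.epi_g hT
  have := e.epi_g hc
  simp only at this
  refine ⟨W, b, j, hp.desc T.g 0 hr, by simp, hp, by simp, ?_⟩
  have h2 : m' ≫ m = 𝟙 C := by rw [← cancel_epi c, reassoc_of% hm', h1, Category.comp_id]
  have h3 : m ≫ m' = 𝟙 _ := by rw [← cancel_epi T.g, reassoc_of% hm]; simp [hm']
  exact e.conflation_of_iso (S := ShortComplex.mk j c w)
    (T := ShortComplex.mk j (hp.desc T.g 0 hr) (by simp))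
    (ShortComplex.isoMk (Iso.refl _) (Iso.refl _) ⟨m', m, h2, h3⟩ (by simp) (by simp [hm'])) hc

/-- `Q` lies in `add P`, expressed by a decomposition of the identity of `Q`. -/
def AddIn (P Q : A) : Prop :=
  ∃ (n : ℕ) (π : Fin n → (Q ⟶ P)) (ι : Fin n → (P ⟶ Q)), ∑ k, π k ≫ ι k = 𝟙 Q

omit [HasFiniteBiproducts A] in
theorem eq_sum_comp {P Q X : A} {n : ℕ} {π : Fin n → (Q ⟶ P)} {ι : Fin n → (P ⟶ Q)}
    (h : ∑ k, π k ≫ ι k = 𝟙 Q) (a : Q ⟶ X) : a = ∑ k, π k ≫ ι k ≫ a := by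
  simp only [← Category.assoc, ← Preadditive.sum_comp, h, Category.id_comp]

/-- Every object is a quotient and a subobject, with respect to the exact structure, of an object
of `add P`, and `P` is both projective and injective. -/
structure ExactStructure.IsFrobeniusGenerator (e : ExactStructure A) (P : A) : Prop where
  isProj : e.IsProj P
  isInj : e.IsInj P
  cover : ∀ X : A, ∃ (Q : A) (p : Q ⟶ X), AddIn P Q ∧ IsDeflation e.conflation p
  cocover : ∀ X : A, ∃ (I : A) (i : X ⟶ I), AddIn P I ∧ IsInflation e.conflation i

end Conflations

/-- `(P, g)` represents the functor `G` to modules, and `g` is a basis of `G.obj P`. -/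
structure Represents {A : Type u} [Category.{v} A] {S : Type v} [Ring S]
    (G : A ⥤ ModuleCat.{v} S) (P : A) (g : G.obj P) : Prop where
  bij : ∀ X : A, Function.Bijective fun a : P ⟶ X => (G.map a).hom g
  basis : Function.Bijective fun s : S => s • g

/-! ### Functors to modules represented by `P` -/

section Represented

variable {A : Type u} [Category.{v} A] {S : Type v} [Ring S]
  {G : A ⥤ ModuleCat.{v} S} {P : A} {g : G.obj P}

theorem map_comp_apply {A : Type u} [Category.{v} A] {S : Type v} [Ring S]
    (G : A ⥤ ModuleCat.{v} S) {X Y Z : A} (a : X ⟶ Y) (b : Y ⟶ Z) (x : G.obj X) :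
    (G.map (a ≫ b)).hom x = (G.map b).hom ((G.map a).hom x) := by simp

theorem Represents.exists_hom (H : Represents G P g) {X : A} (x : G.obj X) :
    ∃ a : P ⟶ X, (G.map a).hom g = x := (H.bij X).2 x

theorem Represents.hom_ext (H : Represents G P g) {X : A} {a b : P ⟶ X}
    (h : (G.map a).hom g = (G.map b).hom g) : a = b := (H.bij X).1 h

theorem Represents.nonempty_equiv (H : Represents G P g) : Nonempty (S ≃ₗ[S] G.obj P) :=
  ⟨LinearEquiv.ofBijective (LinearMap.toSpanSingleton S _ g) H.basis⟩

variable [Preadditive A] [G.Additive]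

theorem map_sum_apply {X Y : A} {n : ℕ} (a : Fin n → (X ⟶ Y)) (x : G.obj X) :
    (G.map (∑ k, a k)).hom x = ∑ k, (G.map (a k)).hom x := by
  rw [G.map_sum, ModuleCat.hom_sum, LinearMap.sum_apply]

theorem map_zero_apply {X Y : A} (x : G.obj X) : (G.map (0 : X ⟶ Y)).hom x = 0 := by
  simp

theorem Represents.eq_zero (H : Represents G P g) {X : A} {a : P ⟶ X}
    (h : (G.map a).hom g = 0) : a = 0 := H.hom_ext (by rw [h, map_zero_apply])

theorem AddIn.projective_finite (H : Represents G P g) {Q : A} (hQ : AddIn P Q) :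
    Module.Projective S (G.obj Q) ∧ Module.Finite S (G.obj Q) := by
  obtain ⟨n, π, ι, h⟩ := hQ
  obtain ⟨E⟩ := H.nonempty_equiv
  have : Module.Free S (G.obj P) := Module.Free.of_equiv E
  have : Module.Finite S (G.obj P) := Module.Finite.equiv E
  let i : G.obj Q →ₗ[S] (Fin n → G.obj P) := LinearMap.pi fun k => (G.map (π k)).hom
  let p : (Fin n → G.obj P) →ₗ[S] G.obj Q := ∑ k, (G.map (ι k)).hom ∘ₗ LinearMap.proj k
  have hip : p ∘ₗ i = LinearMap.id := by
    ext x
    have := map_sum_apply (G := G) (fun k => π k ≫ ι k) x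
    rw [h] at this
    simpa [p, i] using this.symm
  exact ⟨Module.Projective.of_split i p hip,
    Module.Finite.of_surjective p fun x => ⟨i x, LinearMap.congr_fun hip x⟩⟩

omit [G.Additive] in
-- The lift is built on each copy of `P`. Only surjectivity after `G` is needed, so this applies
-- before `b` is known to be a deflation.
theorem AddIn.exists_lift (H : Represents G P g) {Q Y Z : A} (hQ : AddIn P Q) (b : Y ⟶ Z)
    (hb : Function.Surjective (G.map b).hom) (a : Q ⟶ Z) : ∃ l : Q ⟶ Y, l ≫ b = a := by
  obtain ⟨n, π, ι, h⟩ := hQ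
  have (k : Fin n) : ∃ l : P ⟶ Y, l ≫ b = ι k ≫ a := by
    obtain ⟨y, hy⟩ := hb ((G.map (ι k ≫ a)).hom g)
    obtain ⟨l, rfl⟩ := H.exists_hom y
    exact ⟨l, H.hom_ext (by rw [map_comp_apply, hy])⟩
  choose l hl using this
  refine ⟨∑ k, π k ≫ l k, ?_⟩
  simp only [Preadditive.sum_comp, Category.assoc, hl]
  exact (eq_sum_comp h a).symm

end Represented

/-! ### Full faithfulness, exactness and Ext vanishing -/

section Exactness

variable {A : Type u} [Category.{v} A] [Preadditive A] [HasFiniteBiproducts A]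
  {e : ExactStructure A} {S : Type v} [Ring S]
  {G : A ⥤ ModuleCat.{v} S} [G.Additive] {P : A} {g : G.obj P}

variable (H : Represents G P g) (hP : e.IsProj P)
include H

theorem Represents.map_injective {T : ShortComplex A} (hT : e.conflation T) :
    Function.Injective (G.map T.f).hom := by
  have := e.mono_f hT
  refine (injective_iff_map_eq_zero _).2 fun x hx => ?_
  obtain ⟨a, rfl⟩ := H.exists_hom x
  rw [← map_comp_apply] at hx
  rw [zero_of_comp_mono _ (H.eq_zero hx), map_zero_apply]

theorem Represents.map_exact {T : ShortComplex A} (hT : e.conflation T) :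
    Function.Exact (G.map T.f).hom (G.map T.g).hom := by
  intro y
  constructor
  · intro hy
    obtain ⟨a, rfl⟩ := H.exists_hom y
    rw [← map_comp_apply] at hy
    obtain ⟨b, rfl⟩ := e.exists_lift hT a (H.eq_zero hy)
    exact ⟨(G.map b).hom g, (map_comp_apply _ _ _ _).symm⟩
  · rintro ⟨x, rfl⟩
    rw [← map_comp_apply, T.zero, map_zero_apply]

include hP

omit [G.Additive] in
theorem Represents.map_surjective {Y Z : A} {p : Y ⟶ Z} (hp : IsDeflation e.conflation p) :
    Function.Surjective (G.map p).hom := by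
  intro z
  obtain ⟨a, rfl⟩ := H.exists_hom z
  obtain ⟨b, rfl⟩ := hP p hp a
  exact ⟨(G.map b).hom g, (map_comp_apply _ _ _ _).symm⟩

omit hP
variable (hF : e.IsFrobeniusGenerator P)
include hF

theorem Represents.map_eq_zero {X Y : A} {f : X ⟶ Y} (hf : (G.map f).hom = 0) : f = 0 := by
  obtain ⟨Q, p, ⟨n, π, ι, h⟩, K, k, w, hc⟩ := hF.cover X
  have := e.epi_g hc
  simp only at this
  have h0 (k : Fin n) : ι k ≫ p ≫ f = 0 := H.eq_zero (by
    rw [map_comp_apply, map_comp_apply, hf, LinearMap.zero_apply])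
  rw [← cancel_epi p, comp_zero, eq_sum_comp h (p ≫ f)]
  simp [h0]

theorem Represents.map_inj {X Y : A} {f f' : X ⟶ Y} (h : (G.map f).hom = (G.map f').hom) :
    f = f' := by
  rw [← sub_eq_zero]
  exact H.map_eq_zero hF (by rw [G.map_sub, ModuleCat.hom_sub, h, sub_self])

/-- On a cover of `X`, `φ` is determined by its values on the copies of `P`. These values are
morphisms `ψ k : P ⟶ Y`; the map they assemble to kills the kernel of the cover and descends to `X`.
-/
theorem Represents.map_full {X Y : A} (φ : G.obj X →ₗ[S] G.obj Y) :
    ∃ f : X ⟶ Y, (G.map f).hom = φ := by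
  obtain ⟨Q, p, ⟨n, π, ι, h⟩, K, k, w, hc⟩ := hF.cover X
  choose ψ hψ using fun k => H.exists_hom (φ ((G.map (ι k ≫ p)).hom g))
  have key (x : G.obj Q) : (G.map (∑ k, π k ≫ ψ k)).hom x = φ ((G.map p).hom x) := by
    have h1 : (G.map p).hom x = ∑ k, (G.map (π k ≫ ι k ≫ p)).hom x := by
      rw [← map_sum_apply, ← eq_sum_comp h p]
    rw [map_sum_apply, h1, map_sum]
    refine Finset.sum_congr rfl fun k _ => ?_
    -- Since `g` generates `G.obj P`, linearity reduces the comparison to the element `g`.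
    obtain ⟨s, hs⟩ := H.basis.2 ((G.map (π k)).hom x)
    simp only at hs
    rw [map_comp_apply, map_comp_apply, ← hs, map_smul, map_smul, hψ, map_smul]
  obtain ⟨f, hf⟩ := e.exists_desc hc (∑ k, π k ≫ ψ k) (H.map_eq_zero hF (by
    ext x
    rw [map_comp_apply, key, ← map_comp_apply]
    simp [w]))
  refine ⟨f, LinearMap.ext fun x => ?_⟩
  obtain ⟨y, rfl⟩ := H.map_surjective hF.isProj ⟨_, _, _, hc⟩ x
  rw [← map_comp_apply, hf, key]

theorem Represents.fullyFaithful : G.Full ∧ G.Faithful := by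
  refine ⟨⟨fun φ => ?_⟩, ⟨fun h => H.map_inj hF (by rw [h])⟩⟩
  obtain ⟨f, hf⟩ := H.map_full hF φ.hom
  exact ⟨f, by ext1; exact hf⟩

theorem Represents.finite_obj (X : A) : Module.Finite S (G.obj X) := by
  obtain ⟨Q, p, hQ, hp⟩ := hF.cover X
  have := (hQ.projective_finite H).2
  exact Module.Finite.of_surjective _ (H.map_surjective hF.isProj hp)

/-- In degree one, a map from the kernel `K` of a cover to `G.obj P` comes from a morphism `K ⟶ P`,
which extends because `P` is injective. Higher degrees shift to `K`. -/
theorem Represents.extZero_obj (X : A) : ExtZero S (G.obj P) 0 (G.obj X) := by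
  intro i hi
  obtain ⟨i, rfl⟩ : ∃ j, i = j + 1 := ⟨i - 1, by omega⟩
  induction i generalizing X with
  | zero =>
    obtain ⟨Q, p, hQ, K, k, w, hc⟩ := hF.cover X
    have := (hQ.projective_finite H).1
    refine subsingleton_ext_one extZero_of_projective (H.map_injective hc)
      (H.map_surjective hF.isProj ⟨_, _, _, hc⟩) (H.map_exact hc) fun φ => ?_
    obtain ⟨f, rfl⟩ := H.map_full hF φ
    obtain ⟨f', rfl⟩ := hF.isInj k ⟨_, _, _, hc⟩ f
    exact ⟨(G.map f').hom, by ext x; simp⟩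
  | succ i ih =>
    obtain ⟨Q, p, hQ, K, k, w, hc⟩ := hF.cover X
    have := (hQ.projective_finite H).1
    exact subsingleton_ext_succ extZero_of_projective (H.map_injective hc)
      (H.map_surjective hF.isProj ⟨_, _, _, hc⟩) (H.map_exact hc) (ih K (by omega))

theorem Represents.exists_lift_of_exact {X Y Z W : A} {f : X ⟶ Y} {q : Y ⟶ Z}
    (hf : Function.Injective (G.map f).hom) (h : Function.Exact (G.map f).hom (G.map q).hom)
    (a : W ⟶ Y) (ha : a ≫ q = 0) : ∃ b : W ⟶ X, b ≫ f = a := by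
  have hr : ∀ x, (G.map a).hom x ∈ LinearMap.range (G.map f).hom := fun x =>
    (h _).1 (by rw [← map_comp_apply, ha, map_zero_apply])
  obtain ⟨b, hb⟩ := H.map_full hF ((LinearEquiv.ofInjective _ hf).symm.toLinearMap ∘ₗ
    (G.map a).hom.codRestrict _ hr)
  refine ⟨b, H.map_inj hF (LinearMap.ext fun x => ?_)⟩
  rw [map_comp_apply, hb]
  exact congrArg Subtype.val ((LinearEquiv.ofInjective _ hf).apply_symm_apply
    ((G.map a).hom.codRestrict _ hr x))

/-- Lift a cover of `T.X₃` to `T.X₂` and push its conflation out along the induced map of kernels.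
The result is a conflation with the same ends as `T`; by the short five lemma the comparison `u` is
bijective after `G`, hence an isomorphism. -/
theorem Represents.conflation_of_exact {T : ShortComplex A}
    (hf : Function.Injective (G.map T.f).hom) (hg : Function.Surjective (G.map T.g).hom)
    (h : Function.Exact (G.map T.f).hom (G.map T.g).hom) : e.conflation T := by
  obtain ⟨Q, p, hQ, K, k, w, hc⟩ := hF.cover T.X₃
  obtain ⟨l, hl⟩ := hQ.exists_lift H T.g hg p
  obtain ⟨a, ha⟩ := H.exists_lift_of_exact hF hf h (k ≫ l) (by rw [Category.assoc, hl, w])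
  obtain ⟨W, b, j, r, w', hp, hr, hc'⟩ := e.exists_pushout_conflation hc a
  simp only at b r w' hp hr hc'
  let u : W ⟶ T.X₂ := hp.desc l T.f ha.symm
  have hju : j ≫ u = T.f := by simp [u]
  have hu : u ≫ T.g = r := hp.hom_ext (by simp [u, hl, hr]) (by simp [u, w'])
  have hbij : Function.Bijective (G.map u).hom := by
    constructor
    · refine (injective_iff_map_eq_zero _).2 fun x hx => ?_
      obtain ⟨x', rfl⟩ := (H.map_exact hc' x).1 (by
        simp only [← hu]; rw [map_comp_apply, hx, map_zero])
      simp only [← map_comp_apply, hju] at hx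
      rw [(injective_iff_map_eq_zero _).1 hf _ hx, map_zero]
    · intro y
      obtain ⟨z, hz⟩ := H.map_surjective hF.isProj ⟨_, _, _, hc'⟩ ((G.map T.g).hom y)
      obtain ⟨x, hx⟩ := (h (y - (G.map u).hom z)).1 (by
        rw [map_sub, ← map_comp_apply, hu, hz, sub_self])
      refine ⟨z + (G.map j).hom x, ?_⟩
      rw [map_add, ← map_comp_apply, hju, hx]
      abel
  have := (H.fullyFaithful hF).1
  have := (H.fullyFaithful hF).2
  have : IsIso (G.map u) := (ConcreteCategory.isIso_iff_bijective _).2 hbij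
  have : IsIso u := isIso_of_reflects_iso u G
  exact e.conflation_of_iso (S := ShortComplex.mk j r w') (T := T)
    (ShortComplex.isoMk (Iso.refl _) (asIso u) (Iso.refl _) (by simp [hju]) (by simp [hu])) hc'

/-- The cokernel of a monomorphism between objects in the image of `G` lies in the image of `G` if
it has no extensions by `G.obj P`. -/
theorem Represents.exists_equiv_of_shortExact [IsIdempotentComplete A] {X Y : A} (i : X ⟶ Y)
    {M : Type v} [AddCommGroup M] [Module S M] (hM : ExtZero S (G.obj P) 0 M)
    {p : G.obj Y →ₗ[S] M} (hi : Function.Injective (G.map i).hom) (hp : Function.Surjective p)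
    (h : Function.Exact (G.map i).hom p) : ∃ Z : A, Nonempty (G.obj Z ≃ₗ[S] M) := by
  obtain ⟨I, j, ⟨n, π, ι, hI⟩, Z', q, w, hc⟩ := hF.cocover X
  -- Vanishing of `Ext^1(M, G P)` extends each component of `j` along `i`, so `j` factors through
  -- `i`.
  have hk (k : Fin n) : ∃ l : Y ⟶ P, i ≫ l = j ≫ π k := by
    obtain ⟨ψ, hψ⟩ := hM.extend hi hp h (G.map (j ≫ π k)).hom
    obtain ⟨l, rfl⟩ := H.map_full hF ψ
    exact ⟨l, H.map_inj hF (by rw [← hψ]; ext x; simp)⟩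
  choose l hl using hk
  obtain ⟨t, ht⟩ : ∃ t : Y ⟶ I, i ≫ t = j := by
    refine ⟨∑ k, l k ≫ ι k, ?_⟩
    simp only [Preadditive.comp_sum, reassoc_of% hl]
    rw [← Preadditive.comp_sum, hI, Category.comp_id]
  obtain ⟨W, b, j', r', w', hpo, hr, hc'⟩ := e.exists_pushout_conflation hc i
  simp only at b r' w' hpo hr hc'
  -- The factorization `t` splits `b : I ⟶ W`. The complement `Z` of `I` in `W`, cut out by an
  -- idempotent, serves as the cokernel of `i` through `j' ≫ c`.
  let r : W ⟶ I := hpo.desc (𝟙 I) t (by simp [ht])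
  have hbr : b ≫ r = 𝟙 I := by simp [r]
  have hjr : j' ≫ r = t := by simp [r]
  obtain ⟨Z, m, c, hmc, hcm⟩ := IsIdempotentComplete.idempotents_split W (𝟙 W - r ≫ b) (by
    simp [Preadditive.sub_comp, Preadditive.comp_sub, reassoc_of% hbr])
  have hbc : b ≫ c = 0 := by
    rw [← Category.comp_id (b ≫ c), ← hmc]
    simp [reassoc_of% hcm, Preadditive.comp_sub, Preadditive.sub_comp, reassoc_of% hbr]
  have hic : i ≫ j' ≫ c = 0 := by rw [← hpo.w_assoc, hbc, comp_zero]
  have := e.mono_f hc'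
  simp only at this
  refine ⟨Z, nonempty_equiv_of_exact (f := (G.map i).hom) (g := (G.map (j' ≫ c)).hom) ?_ ?_ hp h⟩
  · intro z
    obtain ⟨z, rfl⟩ := H.exists_hom z
    -- Subtracting a morphism through `I` moves `z ≫ m` into the image of `j'` and does not change
    -- its image in `Z`, since `b ≫ c = 0`.
    obtain ⟨a, ha⟩ := hF.isProj q ⟨_, _, _, hc⟩ (z ≫ m ≫ r')
    obtain ⟨s, hs⟩ := e.exists_lift hc' (z ≫ m - a ≫ b) (by
      simp [Preadditive.sub_comp, ha, hr])
    simp only at hs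
    refine ⟨(G.map s).hom g, ?_⟩
    rw [← map_comp_apply, reassoc_of% hs, Preadditive.sub_comp]
    simp [hmc, hbc]
  · intro y
    constructor
    · intro hy
      obtain ⟨s, rfl⟩ := H.exists_hom y
      rw [← map_comp_apply] at hy
      have h0 : s ≫ j' ≫ c ≫ m = 0 := by
        rw [← Category.assoc j', ← Category.assoc s, H.eq_zero hy, zero_comp]
      rw [hcm] at h0
      have h1 : s ≫ j' = s ≫ t ≫ b := by
        simpa [Preadditive.comp_sub, sub_eq_zero, reassoc_of% hjr] using h0
      have h2 : s ≫ t ≫ q = 0 := by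
        rw [← hr, ← Category.assoc t, ← Category.assoc s, ← h1, Category.assoc, w', comp_zero]
      obtain ⟨x, hx⟩ := e.exists_lift hc (s ≫ t) (by simpa using h2)
      simp only at hx
      have h3 : s = x ≫ i := by
        rw [← cancel_mono j', h1, Category.assoc, ← hpo.w, reassoc_of% hx]
      exact ⟨(G.map x).hom g, by rw [← map_comp_apply, h3]⟩
    · rintro ⟨x, rfl⟩
      rw [← map_comp_apply, hic, map_zero_apply]

end Exactness

/-! ### Transformations out of representable functors, projectives of `mod A` -/

section Yoneda

variable {A : Type u} [Category.{v} A] [Preadditive A]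

/-- The value at `a : W ⟶ X` of a transformation out of the functor represented by `X`. -/
def evalAt {X : A} {F : Aᵒᵖ ⥤ AddCommGrpCat.{v}} (ψ : preadditiveYoneda.obj X ⟶ F) (W : A) :
    (W ⟶ X) →+ F.obj (.op W) := (ψ.app (.op W)).hom

variable {X Y : A} {F F' : Aᵒᵖ ⥤ AddCommGrpCat.{v}}

theorem evalAt_comp (ψ : preadditiveYoneda.obj X ⟶ F) {W W' : A} (c : W' ⟶ W) (a : W ⟶ X) :
    evalAt ψ W' (c ≫ a) = (F.map c.op).hom (evalAt ψ W a) :=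
  congrArg (fun h => h.hom a) (ψ.naturality c.op)

theorem evalAt_map_comp (f : X ⟶ Y) (ψ : preadditiveYoneda.obj Y ⟶ F) {W : A} (a : W ⟶ X) :
    evalAt (preadditiveYoneda.map f ≫ ψ) W a = evalAt ψ W (a ≫ f) := rfl

theorem evalAt_comp_app (ψ : preadditiveYoneda.obj X ⟶ F) (φ : F ⟶ F') {W : A} (a : W ⟶ X) :
    evalAt (ψ ≫ φ) W a = (φ.app (.op W)).hom (evalAt ψ W a) := rfl

theorem evalAt_eq (ψ : preadditiveYoneda.obj X ⟶ F) {W : A} (a : W ⟶ X) :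
    evalAt ψ W a = (F.map a.op).hom (evalAt ψ X (𝟙 X)) := by
  rw [← evalAt_comp, Category.comp_id]

theorem evalAt_ext {ψ ψ' : preadditiveYoneda.obj X ⟶ F} (h : evalAt ψ X (𝟙 X) = evalAt ψ' X (𝟙 X)) :
    ψ = ψ' := by
  ext W a
  exact (evalAt_eq ψ (W := W.unop) a).trans ((congrArg _ h).trans (evalAt_eq ψ' a).symm)

omit [Preadditive A] in
theorem surjective_app_of_epi (φ : F ⟶ F') [Epi φ] (W : Aᵒᵖ) :
    Function.Surjective (φ.app W).hom :=
  (AddCommGrpCat.epi_iff_surjective _).1 inferInstance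

omit [Preadditive A] in
theorem shortExact_app {T : ShortComplex (Aᵒᵖ ⥤ AddCommGrpCat.{v})} (hT : T.ShortExact)
    (W : Aᵒᵖ) : Function.Injective (T.f.app W).hom ∧ Function.Surjective (T.g.app W).hom ∧
      Function.Exact (T.f.app W).hom (T.g.app W).hom := by
  have := hT.map_of_exact ((evaluation _ _).obj W)
  exact ⟨this.ab_injective_f, this.ab_surjective_g,
    (ShortComplex.ab_exact_iff_function_exact _).1 this.exact⟩

theorem evalAt_cokernel_surjective (f : X ⟶ Y) (W : A) :
    Function.Surjective (evalAt (cokernel.π (preadditiveYoneda.map f)) W) :=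
  surjective_app_of_epi (cokernel.π (preadditiveYoneda.map f)) (.op W)

theorem evalAt_cokernel_eq_zero (f : X ⟶ Y) {W : A} (a : W ⟶ Y) :
    evalAt (cokernel.π (preadditiveYoneda.map f)) W a = 0 ↔ ∃ b : W ⟶ X, b ≫ f = a := by
  have := (ShortComplex.exact_cokernel (preadditiveYoneda.map f)).map
    ((evaluation _ _).obj (.op W))
  exact (ShortComplex.ab_exact_iff_function_exact _).1 this a

theorem isFinPres_yoneda (X : A) : isFinPres A (preadditiveYoneda.obj X) :=
  ⟨X, X, 0, ⟨cokernelZeroIsoTarget.symm ≪≫ (cokernelIsoOfEq (by simp)).symm⟩⟩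

/-- The functor represented by `X`, as an object of `mod A`. -/
abbrev yonedaMod (X : A) : FunMod A := ⟨preadditiveYoneda.obj X, isFinPres_yoneda X⟩

/-- A projective is a retract of a representable functor. By Yoneda the retraction gives an
idempotent of the representing object, which splits. -/
theorem exists_yoneda_iso_of_projective [IsIdempotentComplete A] (F : FunMod A) [Projective F] :
    ∃ X : A, Nonempty (preadditiveYoneda.obj X ≅ F.obj) := by
  obtain ⟨X, Y, f, ⟨φ⟩⟩ := F.property
  let p : yonedaMod Y ⟶ F := ObjectProperty.homMk (cokernel.π (preadditiveYoneda.map f) ≫ φ.inv)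
  have : Epi ((isFinPres A).ι.map p) := inferInstanceAs (Epi (cokernel.π _ ≫ φ.inv))
  have : Epi p := (isFinPres A).ι.epi_of_epi_map this
  let s := Projective.factorThru (𝟙 F) p
  have hs : s.hom ≫ p.hom = 𝟙 F.obj :=
    congrArg InducedCategory.Hom.hom (Projective.factorThru_comp (𝟙 F) p)
  obtain ⟨c, hc⟩ := preadditiveYoneda.map_surjective (p.hom ≫ s.hom)
  obtain ⟨Z, i, q, hiq, hqi⟩ := IsIdempotentComplete.idempotents_split Y c
    (preadditiveYoneda.map_injective (by simp [hc, reassoc_of% hs]))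
  refine ⟨Z, ⟨preadditiveYoneda.map i ≫ p.hom, s.hom ≫ preadditiveYoneda.map q, ?_, ?_⟩⟩
  · rw [Category.assoc, ← Category.assoc p.hom, ← hc, ← Functor.map_comp, ← Functor.map_comp,
      ← hqi, Category.assoc, hiq, Category.comp_id, hiq]
    exact preadditiveYoneda.map_id Z
  · rw [Category.assoc, ← Category.assoc (preadditiveYoneda.map q), ← Functor.map_comp, hqi, hc,
      Category.assoc, hs, Category.comp_id, hs]

theorem exists_hasProjDimLE_of_gldimMod_le {d : ℕ} (h : gldimMod A ≤ d) (F : FunMod A) :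
    ∃ n ≤ d, FunMod.HasProjDimLE n F := by
  have h1 : F.projDim ≤ d := (le_iSup (fun F : FunMod A => F.projDim) F).trans h
  by_contra! h2
  have : ((d + 1 : ℕ) : ℕ∞) ≤ F.projDim := le_iInf₂ fun n hn => by
    by_contra! h3
    exact h2 n (by have := Nat.cast_lt.1 h3; omega) hn
  have := Nat.cast_le.1 (this.trans h1)
  omega

end Yoneda

/-! ### Resolving modules by evaluating functors at `P` -/

section Resolutions

variable {A : Type u} [Category.{v} A] [Preadditive A] {S : Type v} [Ring S]

/-- `M` has a resolution of length at most `n` by modules in the image of `G`. -/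
def HasResLE (G : A ⥤ ModuleCat.{v} S) : ℕ → ModuleCat.{v} S → Prop
  | 0, M => ∃ X : A, Nonempty (G.obj X ≃ₗ[S] M)
  | n + 1, M => ∃ (M' : ModuleCat.{v} S) (X : A) (f : M' →ₗ[S] G.obj X) (p : G.obj X →ₗ[S] M),
      Function.Injective f ∧ Function.Surjective p ∧ Function.Exact f p ∧ HasResLE G n M'

variable {G : A ⥤ ModuleCat.{v} S} {P : A} {g : G.obj P}

/-- The module `M` is the value at `P` of the functor `F`. -/
def IsValue (G : A ⥤ ModuleCat.{v} S) {P : A} (g : G.obj P) (F : Aᵒᵖ ⥤ AddCommGrpCat.{v})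
    (M : Type v) [AddCommGroup M] [Module S M] : Prop :=
  ∃ θ : F.obj (.op P) →+ M, Function.Bijective θ ∧ ∀ (c : P ⟶ P) (s : S),
    (G.map c).hom g = s • g → ∀ x, θ ((F.map c.op).hom x) = s • θ x

variable [G.Additive]

/-- The additive isomorphism between `Hom(P, X)` and `G.obj X`. -/
noncomputable def Represents.homEquiv (H : Represents G P g) (X : A) : (P ⟶ X) ≃+ G.obj X :=
  AddEquiv.ofBijective
    (AddMonoidHom.mk' (fun a : P ⟶ X => (G.map a).hom g) fun a b => by simp) (H.bij X)

theorem Represents.homEquiv_apply (H : Represents G P g) {X : A} (a : P ⟶ X) :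
    H.homEquiv X a = (G.map a).hom g := rfl

theorem Represents.homEquiv_comp (H : Represents G P g) {X : A} {c : P ⟶ P} {s : S}
    (hc : (G.map c).hom g = s • g) (a : P ⟶ X) :
    H.homEquiv X (c ≫ a) = s • H.homEquiv X a := by
  rw [H.homEquiv_apply, map_comp_apply, hc, map_smul, H.homEquiv_apply]

theorem Represents.exists_linearMap (H : Represents G P g) {F : Aᵒᵖ ⥤ AddCommGrpCat.{v}}
    {M : Type v} [AddCommGroup M] [Module S M] {θ : F.obj (.op P) →+ M}
    (hθ : ∀ (c : P ⟶ P) (s : S), (G.map c).hom g = s • g →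
      ∀ x, θ ((F.map c.op).hom x) = s • θ x)
    {X : A} (ψ : preadditiveYoneda.obj X ⟶ F) :
    ∃ l : G.obj X →ₗ[S] M, ∀ a : P ⟶ X, l (H.homEquiv X a) = θ (evalAt ψ P a) := by
  refine ⟨{ toFun := fun x => θ (evalAt ψ P ((H.homEquiv X).symm x))
            map_add' := fun x y => by simp
            map_smul' := fun s x => ?_ }, fun a => by simp⟩
  obtain ⟨a, rfl⟩ := (H.homEquiv X).surjective x
  obtain ⟨c, hc⟩ := H.exists_hom (s • g)
  rw [← H.homEquiv_comp hc]
  simp only [AddEquiv.symm_apply_apply, RingHom.id_apply]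
  rw [evalAt_comp, hθ c s hc]

/-- Exactness in the resolution is pointwise and its projective terms are representable, so
evaluation at `P` gives a resolution by modules `G.obj X`. -/
theorem Represents.hasResLE [IsIdempotentComplete A] (H : Represents G P g) {n : ℕ} :
    ∀ {F : FunMod A}, FunMod.HasProjDimLE n F → ∀ (M : ModuleCat.{v} S),
      IsValue G g F.obj M → HasResLE G n M := by
  induction n with
  | zero =>
    intro F hF M ⟨θ, hb, hθ⟩
    have : Projective F := hF
    obtain ⟨X, ⟨φ⟩⟩ := exists_yoneda_iso_of_projective F
    obtain ⟨l, hl⟩ := H.exists_linearMap hθ φ.hom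
    have hφ : Function.Bijective (evalAt φ.hom P) :=
      ConcreteCategory.bijective_of_isIso (φ.hom.app (.op P))
    have hc : Function.Bijective (l ∘ H.homEquiv X) := by
      rw [show l ∘ H.homEquiv X = θ ∘ evalAt φ.hom P from funext hl]
      exact hb.comp hφ
    exact ⟨X, ⟨LinearEquiv.ofBijective l
      ((Function.Bijective.of_comp_iff l (H.homEquiv X).bijective).1 hc)⟩⟩
  | succ n ih =>
    intro F ⟨T, hT, hp, ⟨φ⟩, hn⟩ M ⟨θ, hb, hθ⟩
    obtain ⟨X, ⟨χ⟩⟩ := exists_yoneda_iso_of_projective T.X₂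
    obtain ⟨hinj, hsurj, hex⟩ := shortExact_app hT (.op P)
    obtain ⟨l, hl⟩ := H.exists_linearMap hθ (χ.hom ≫ T.g.hom ≫ φ.hom.hom)
    have hχ : Function.Bijective (evalAt χ.hom P) :=
      ConcreteCategory.bijective_of_isIso (χ.hom.app (.op P))
    have hφ : Function.Bijective (φ.hom.hom.app (.op P)).hom :=
      ConcreteCategory.bijective_of_isIso (φ.hom.hom.app (.op P))
    have hl' (a : P ⟶ X) : l (H.homEquiv X a) =
        θ ((φ.hom.hom.app (.op P)).hom ((T.g.hom.app (.op P)).hom (evalAt χ.hom P a))) := hl a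
    refine ⟨ModuleCat.of S (LinearMap.ker l), X, (LinearMap.ker l).subtype, l,
      Subtype.val_injective, ?_, LinearMap.exact_subtype_ker_map l, ih hn _ ?_⟩
    · intro m
      obtain ⟨x, rfl⟩ := hb.2 m
      obtain ⟨x, rfl⟩ := hφ.2 x
      obtain ⟨x, rfl⟩ := hsurj x
      obtain ⟨a, rfl⟩ := hχ.2 x
      exact ⟨H.homEquiv X a, hl' a⟩
    -- `ε` identifies the middle term at `P` with `G.obj X` and carries the image of `T.f` onto `ker
    -- l`, so `ker l` is the value at `P` of the first term.
    · let ε : T.X₂.obj.obj (.op P) →+ G.obj X :=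
        (H.homEquiv X).toAddMonoidHom.comp (χ.inv.app (.op P)).hom
      have hε (a : P ⟶ X) : ε (evalAt χ.hom P a) = H.homEquiv X a := by
        have : (χ.inv.app (.op P)).hom (evalAt χ.hom P a) = a :=
          ConcreteCategory.congr_hom (χ.hom_inv_id_app (.op P)) a
        exact congrArg (H.homEquiv X) this
      have hε' : Function.Injective ε := fun x y h => by
        obtain ⟨a, rfl⟩ := hχ.2 x
        obtain ⟨b, rfl⟩ := hχ.2 y
        rw [hε, hε] at h
        rw [(H.homEquiv X).injective h]
      have hker (x) : l (ε x) = 0 ↔ (T.g.hom.app (.op P)).hom x = 0 := by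
        obtain ⟨a, rfl⟩ := hχ.2 x
        rw [hε, hl', map_eq_zero_iff _ hb.1, map_eq_zero_iff _ hφ.1]
      refine ⟨(ε.comp (T.f.hom.app (.op P)).hom).codRestrict (LinearMap.ker l).toAddSubgroup
        fun x => (hker _).2 ((hex _).2 ⟨x, rfl⟩), ⟨fun x y h => ?_, fun y => ?_⟩, ?_⟩
      · exact hinj (hε' (congrArg Subtype.val h))
      · obtain ⟨y, hy⟩ := y
        obtain ⟨a, rfl⟩ := (H.homEquiv X).surjective y
        rw [← hε] at hy
        obtain ⟨x, hx⟩ := (hex _).1 ((hker _).1 hy)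
        refine ⟨x, Subtype.ext ?_⟩
        have : ε ((T.f.hom.app (.op P)).hom x) = H.homEquiv X a := by rw [← hε]; exact congrArg ε hx
        exact this
      · intro c s hc x
        refine Subtype.ext ?_
        have h1 : (T.f.hom.app (.op P)).hom ((T.X₁.obj.map c.op).hom x) =
            (T.X₂.obj.map c.op).hom ((T.f.hom.app (.op P)).hom x) :=
          ConcreteCategory.congr_hom (T.f.hom.naturality c.op) x
        obtain ⟨a, ha⟩ := hχ.2 ((T.f.hom.app (.op P)).hom x)
        have h2 : ε ((T.f.hom.app (.op P)).hom ((T.X₁.obj.map c.op).hom x)) =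
            s • ε ((T.f.hom.app (.op P)).hom x) := by
          rw [h1, ← ha, ← evalAt_comp, hε, hε, H.homEquiv_comp hc]
        exact h2

variable [HasFiniteBiproducts A]

omit [G.Additive] in
theorem addIn_biproduct (n : ℕ) (P : A) : AddIn P (⨁ fun _ : Fin n => P) :=
  ⟨n, biproduct.π fun _ : Fin n => P, biproduct.ι fun _ : Fin n => P,
    biproduct.total (f := fun _ : Fin n => P)⟩

theorem Represents.exists_cover_module (H : Represents G P g) (M : Type v) [AddCommGroup M]
    [Module S M] [Module.Finite S M] :
    ∃ (n : ℕ) (p : G.obj (⨁ fun _ : Fin n => P) →ₗ[S] M), Function.Surjective p := by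
  obtain ⟨n, q, hq⟩ := Module.Finite.exists_fin' S M
  obtain ⟨E⟩ := H.nonempty_equiv
  refine ⟨n, q ∘ₗ LinearMap.pi fun k => E.symm.toLinearMap ∘ₗ
    (G.map (biproduct.π (fun _ : Fin n => P) k)).hom, hq.comp fun y => ?_⟩
  refine ⟨∑ k, (G.map (biproduct.ι (fun _ : Fin n => P) k)).hom (E (y k)), ?_⟩
  ext j
  simp only [LinearMap.pi_apply, LinearMap.comp_apply, map_sum, ← map_comp_apply]
  rw [Finset.sum_eq_single j]
  · simp
  · intro k _ hk
    simp [biproduct.ι_π_ne _ hk]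
  · simp

/-- Since `S` is noetherian, `M` has a presentation by powers of `G.obj P`, which fullness lifts to
a morphism `f`. The cokernel of `Hom(-, f)` takes the value `M` at `P`. -/
theorem Represents.exists_isValue [IsNoetherianRing S] (H : Represents G P g)
    (hfull : G.Full) (M : Type v) [AddCommGroup M] [Module S M] [Module.Finite S M] :
    ∃ F : FunMod A, IsValue G g F.obj M := by
  obtain ⟨n, p, hp⟩ := H.exists_cover_module M
  have := ((addIn_biproduct n P).projective_finite H).2
  obtain ⟨m, q, hq⟩ := H.exists_cover_module (LinearMap.ker p)
  obtain ⟨f, hf⟩ := G.map_surjective (ModuleCat.ofHom ((LinearMap.ker p).subtype ∘ₗ q))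
  let π := evalAt (cokernel.π (preadditiveYoneda.map f)) P
  have hπ : Function.Surjective π := evalAt_cokernel_surjective f P
  let h : (P ⟶ ⨁ fun _ : Fin n => P) →+ M := p.toAddMonoidHom.comp (H.homEquiv _).toAddMonoidHom
  have hfq (x) : (G.map f).hom x = (q x : G.obj (⨁ fun _ : Fin n => P)) := by rw [hf]; rfl
  have hker (a) : π a = 0 ↔ h a = 0 := by
    rw [evalAt_cokernel_eq_zero]
    constructor
    · rintro ⟨b, rfl⟩
      change p ((G.map (b ≫ f)).hom g) = 0
      rw [map_comp_apply, hfq]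
      exact (q _).2
    · intro ha
      obtain ⟨x, hx⟩ := hq ⟨H.homEquiv _ a, ha⟩
      obtain ⟨b, rfl⟩ := (H.homEquiv _).surjective x
      refine ⟨b, (H.homEquiv _).injective ?_⟩
      rw [H.homEquiv_apply, map_comp_apply, hfq, ← H.homEquiv_apply, hx]
  let θ := π.liftOfSurjective hπ ⟨h, fun a ha => (hker a).1 ha⟩
  have hθ (a) : θ (π a) = h a := AddMonoidHom.liftOfRightInverse_comp_apply _ _ _ _ a
  refine ⟨⟨cokernel (preadditiveYoneda.map f), _, _, f, ⟨Iso.refl _⟩⟩, θ, ⟨?_, ?_⟩, ?_⟩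
  · refine (injective_iff_map_eq_zero _).2 fun x hx => ?_
    obtain ⟨a, rfl⟩ := hπ x
    rw [hθ] at hx
    exact (hker a).2 hx
  · intro y
    obtain ⟨x, rfl⟩ := hp y
    obtain ⟨a, rfl⟩ := (H.homEquiv _).surjective x
    exact ⟨π a, hθ a⟩
  · intro c s hc x
    obtain ⟨a, rfl⟩ := hπ x
    have : ((cokernel (preadditiveYoneda.map f)).map c.op).hom (π a) = π (c ≫ a) :=
      (evalAt_comp _ c a).symm
    change θ (((cokernel (preadditiveYoneda.map f)).map c.op).hom (π a)) = _
    rw [this, hθ, hθ]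
    change p (H.homEquiv _ (c ≫ a)) = s • p (H.homEquiv _ a)
    rw [H.homEquiv_comp hc, map_smul]

variable {e : ExactStructure A} (H : Represents G P g) (hF : e.IsFrobeniusGenerator P)
include H hF

theorem Represents.extZero_of_hasResLE {n : ℕ} :
    ∀ M : ModuleCat.{v} S, HasResLE G n M → ExtZero S (G.obj P) n M := by
  induction n with
  | zero =>
    rintro M ⟨X, ⟨E⟩⟩
    exact (H.extZero_obj hF X).of_equiv E
  | succ n ih =>
    rintro M ⟨M', X, f, p, hf, hp, h, hM'⟩
    exact ((H.extZero_obj hF X).shift hf hp h).2 (ih _ hM')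

/-- The syzygy `M'` inherits the Ext vanishing and comes from an object by induction. So `M` is the
cokernel of a morphism between objects, and `exists_equiv_of_shortExact` applies. -/
theorem Represents.exists_obj_of_hasResLE [IsIdempotentComplete A] {n : ℕ} :
    ∀ M : ModuleCat.{v} S, HasResLE G n M → ExtZero S (G.obj P) 0 M →
      ∃ X : A, Nonempty (G.obj X ≃ₗ[S] M) := by
  induction n with
  | zero => exact fun M hM _ => hM
  | succ n ih =>
    rintro M ⟨M', X, f, p, hf, hp, h, hM'⟩ hM
    obtain ⟨X', ⟨E⟩⟩ := ih M' hM' (((H.extZero_obj hF X).shift hf hp h).1 (hM.mono zero_le_one))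
    obtain ⟨i, hi⟩ := H.map_full hF (f ∘ₗ E.toLinearMap)
    refine H.exists_equiv_of_shortExact hF i hM (p := p) ?_ hp ?_
    · rw [hi]; exact hf.comp E.injective
    · intro y
      rw [hi, h y]
      simp [E.surjective.exists]

theorem Represents.exists_hasResLE [IsNoetherianRing S] [IsIdempotentComplete A] {d : ℕ}
    (hd : gldimMod A ≤ d) (M : Type v) [AddCommGroup M] [Module S M] [Module.Finite S M] :
    ∃ n ≤ d, HasResLE G n (ModuleCat.of S M) := by
  obtain ⟨F, hFM⟩ := H.exists_isValue (H.fullyFaithful hF).1 M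
  obtain ⟨n, hn, hFn⟩ := exists_hasProjDimLE_of_gldimMod_le hd F
  exact ⟨n, hn, H.hasResLE hFn _ hFM⟩

theorem Represents.exists_obj [IsNoetherianRing S] [IsIdempotentComplete A] {d : ℕ}
    (hd : gldimMod A ≤ d) (M : Type v) [AddCommGroup M] [Module S M] [Module.Finite S M]
    (hM : ExtZero S (G.obj P) 0 M) : ∃ X : A, Nonempty (G.obj X ≃ₗ[S] M) := by
  obtain ⟨n, -, h⟩ := H.exists_hasResLE hF hd M
  exact H.exists_obj_of_hasResLE hF _ h hM

theorem Represents.hasInjectiveDimensionLE [IsNoetherianRing S] [IsIdempotentComplete A] {d : ℕ}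
    (hd : gldimMod A ≤ d) : HasInjectiveDimensionLE (ModuleCat.of S (G.obj P)) d := by
  refine hasInjectiveDimensionLE_of_extZero d _ fun I => ?_
  obtain ⟨n, hn, h⟩ := H.exists_hasResLE hF hd (S ⧸ I)
  exact (H.extZero_of_hasResLE hF _ h).mono hn

end Resolutions

/-! ### The opposite exact structure -/

section Opposite

variable {A : Type u} [Category.{v} A] [Preadditive A] [HasFiniteBiproducts A]

instance hasFiniteBiproducts_op : HasFiniteBiproducts Aᵒᵖ :=
  HasFiniteBiproducts.of_hasFiniteProducts

omit [HasFiniteBiproducts A] in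
theorem isInflation_op_iff {c : ShortComplex A → Prop} {X Y : Aᵒᵖ} (f : X ⟶ Y) :
    IsInflation (fun T : ShortComplex Aᵒᵖ => c T.unop) f ↔ IsDeflation c f.unop :=
  ⟨fun ⟨Z, q, w, h⟩ => ⟨Z.unop, q.unop, congrArg Quiver.Hom.unop w, h⟩,
    fun ⟨Z, q, w, h⟩ => ⟨.op Z, q.op, congrArg Quiver.Hom.op w, h⟩⟩

omit [HasFiniteBiproducts A] in
theorem isDeflation_op_iff {c : ShortComplex A → Prop} {X Y : Aᵒᵖ} (f : X ⟶ Y) :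
    IsDeflation (fun T : ShortComplex Aᵒᵖ => c T.unop) f ↔ IsInflation c f.unop :=
  ⟨fun ⟨Z, q, w, h⟩ => ⟨Z.unop, q.unop, congrArg Quiver.Hom.unop w, h⟩,
    fun ⟨Z, q, w, h⟩ => ⟨.op Z, q.op, congrArg Quiver.Hom.op w, h⟩⟩

/-- The opposite of an exact structure. -/
def ExactStructure.op (e : ExactStructure A) : ExactStructure Aᵒᵖ where
  conflation T := e.conflation T.unop
  conflation_of_iso φ h := e.conflation_of_iso
    ⟨ShortComplex.unopMap φ.inv, ShortComplex.unopMap φ.hom,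
      congrArg ShortComplex.unopMap φ.hom_inv_id, congrArg ShortComplex.unopMap φ.inv_hom_id⟩ h
  isKernel h := (e.isCokernel h).map fun hl =>
    CokernelCofork.IsColimit.ofπOp _ _ hl
  isCokernel h := (e.isKernel h).map fun hl =>
    KernelFork.IsLimit.ofιOp _ _ hl
  inflation_id X := (isInflation_op_iff _).2 (e.deflation_id _)
  deflation_id X := (isDeflation_op_iff _).2 (e.inflation_id _)
  inflation_comp f g hf hg := (isInflation_op_iff _).2
    (e.deflation_comp _ _ ((isInflation_op_iff _).1 hg) ((isInflation_op_iff _).1 hf))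
  deflation_comp f g hf hg := (isDeflation_op_iff _).2
    (e.inflation_comp _ _ ((isDeflation_op_iff _).1 hg) ((isDeflation_op_iff _).1 hf))
  exists_pushout i a hi := by
    obtain ⟨Y, b, q, h, hq⟩ := e.exists_pullback i.unop a.unop ((isInflation_op_iff _).1 hi)
    exact ⟨.op Y, b.op, q.op, h.op.flip, (isInflation_op_iff _).2 hq⟩
  exists_pullback p a hp := by
    obtain ⟨Y, b, j, h, hj⟩ := e.exists_pushout p.unop a.unop ((isDeflation_op_iff _).1 hp)
    exact ⟨.op Y, b.op, j.op, h.op.flip, (isDeflation_op_iff _).2 hj⟩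

omit [HasFiniteBiproducts A] in
theorem AddIn.op {P Q : A} (h : AddIn P Q) : AddIn (Opposite.op P) (Opposite.op Q) := by
  obtain ⟨n, π, ι, h⟩ := h
  refine ⟨n, fun k => (ι k).op, fun k => (π k).op, ?_⟩
  rw [← op_id, ← h, op_sum]
  rfl

theorem ExactStructure.IsFrobeniusGenerator.op {e : ExactStructure A} {P : A}
    (h : e.IsFrobeniusGenerator P) : e.op.IsFrobeniusGenerator (Opposite.op P) where
  isProj Y Z p hp f := by
    obtain ⟨l, hl⟩ := h.isInj p.unop ((isDeflation_op_iff _).1 hp) f.unop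
    exact ⟨l.op, congrArg Quiver.Hom.op hl⟩
  isInj Y Z i hi f := by
    obtain ⟨l, hl⟩ := h.isProj i.unop ((isInflation_op_iff _).1 hi) f.unop
    exact ⟨l.op, congrArg Quiver.Hom.op hl⟩
  cover X := by
    obtain ⟨I, i, hI, hi⟩ := h.cocover X.unop
    exact ⟨.op I, i.op, hI.op, (isDeflation_op_iff _).2 hi⟩
  cocover X := by
    obtain ⟨I, i, hI, hi⟩ := h.cover X.unop
    exact ⟨.op I, i.op, hI.op, (isInflation_op_iff _).2 hi⟩

end Opposite

/-! ### The functors `Hom(P, -)` and `Hom(-, P)` -/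

section HomFunctors

variable {E : Type u} [Category.{v} E] [Preadditive E] (P : E)

theorem represents_coyoneda :
    Represents (preadditiveCoyonedaObj P) P (𝟙 P : P ⟶ P) where
  bij X := ⟨fun a b h => ((Category.id_comp a).symm.trans h).trans (Category.id_comp b),
    fun x => ⟨x, Category.id_comp (X := P) (Y := X) x⟩⟩
  basis := ⟨fun a b h => MulOpposite.unop_injective
      (((Category.comp_id (a.unop : P ⟶ P)).symm.trans h).trans (Category.comp_id (b.unop : P ⟶ P))),
    fun x => ⟨MulOpposite.op x, Category.comp_id (X := P) (Y := P) x⟩⟩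

theorem represents_yoneda :
    Represents (preadditiveYonedaObj P) (Opposite.op P) (𝟙 P : P ⟶ P) where
  bij X := ⟨fun a b h => Quiver.Hom.unop_inj
      (((Category.comp_id a.unop).symm.trans h).trans (Category.comp_id b.unop)),
    fun x => ⟨Quiver.Hom.op x, Category.comp_id (X := X.unop) (Y := P) x⟩⟩
  basis := ⟨fun a b h =>
      ((Category.id_comp (a : P ⟶ P)).symm.trans h).trans (Category.id_comp (b : P ⟶ P)),
    fun x => ⟨x, Category.id_comp (X := P) (Y := P) x⟩⟩

end HomFunctors

/-! ### From the conditions to the exact equivalence -/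

section AddBiproduct

variable {E : Type u} [Category.{v} E] [Preadditive E] [HasFiniteBiproducts E]

attribute [local instance] hasBinaryBiproducts_of_finite_biproducts

theorem IsInAdd.addIn {P X : E} (h : IsInAdd P X) : AddIn P X := by
  obtain ⟨n, Y, ⟨φ⟩⟩ := h
  refine ⟨n, fun k => biprod.inl ≫ φ.hom ≫ biproduct.π (fun _ : Fin n => P) k,
    fun k => biproduct.ι (fun _ : Fin n => P) k ≫ φ.inv ≫ biprod.fst, ?_⟩
  have := eq_sum_comp (biproduct.total (f := fun _ : Fin n => P)) (φ.inv ≫ biprod.fst)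
  calc _ = biprod.inl ≫ φ.hom ≫ φ.inv ≫ biprod.fst := by
        conv_rhs => rw [this]
        simp [Preadditive.comp_sum]
    _ = 𝟙 X := by simp

theorem isInAdd_self (P : E) : IsInAdd P P := by
  have h0 : IsZero (⨁ fun _ : Fin 0 => P) := by
    rw [IsZero.iff_id_eq_zero]
    exact biproduct.hom_ext _ _ fun k => k.elim0
  exact ⟨1, _, ⟨(isoBiprodZero h0).symm ≪≫ (biproductUniqueIso fun _ : Fin 1 => P).symm⟩⟩

variable {e : ExactStructure E} {P : E}

theorem SatisfiesConditions.isFrobeniusGenerator (h : SatisfiesConditions e P) :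
    e.IsFrobeniusGenerator P where
  isProj := (h.proj_eq_add P).2 (isInAdd_self P)
  isInj := (h.frobenius.proj_iff_inj P).1 ((h.proj_eq_add P).2 (isInAdd_self P))
  cover X := by
    obtain ⟨Q, p, hQ, hp⟩ := h.frobenius.enoughProj X
    exact ⟨Q, p, ((h.proj_eq_add Q).1 hQ).addIn, hp⟩
  cocover X := by
    obtain ⟨I, i, hI, hi⟩ := h.frobenius.enoughInj X
    exact ⟨I, i, ((h.proj_eq_add I).1 ((h.frobenius.proj_iff_inj I).2 hI)).addIn, hi⟩

theorem ModuleCat.shortExact_iff {S : Type v} [Ring S] (T : ShortComplex (ModuleCat.{v} S)) :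
    T.ShortExact ↔ Function.Injective T.f.hom ∧ Function.Surjective T.g.hom ∧
      Function.Exact T.f.hom T.g.hom :=
  ⟨fun h => ⟨(ModuleCat.mono_iff_injective _).1 h.mono_f, (ModuleCat.epi_iff_surjective _).1 h.epi_g,
    (ShortComplex.ShortExact.moduleCat_exact_iff_function_exact _).1 h.exact⟩,
    fun ⟨h1, h2, h3⟩ => shortExact_of h1 h2 h3⟩

omit [HasFiniteBiproducts E] in
theorem GP.conflation_homGP_iff {h : ∀ X, isGP (End P) ((preadditiveCoyonedaObj P).obj X)}
    (T : ShortComplex E) : GP.conflation (T.map (homGP P h)) ↔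
      Function.Injective ((preadditiveCoyonedaObj P).map T.f).hom ∧
      Function.Surjective ((preadditiveCoyonedaObj P).map T.g).hom ∧
      Function.Exact ((preadditiveCoyonedaObj P).map T.f).hom
        ((preadditiveCoyonedaObj P).map T.g).hom :=
  ModuleCat.shortExact_iff (T.map (preadditiveCoyonedaObj P))

omit [HasFiniteBiproducts E] in
theorem isGP_iff (M : ModuleCat.{v} (End P)ᵐᵒᵖ) :
    isGP (End P) M ↔ Module.Finite (End P)ᵐᵒᵖ M ∧
      ExtZero (End P)ᵐᵒᵖ ((preadditiveCoyonedaObj P).obj P) 0 M := Iff.rfl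

theorem SatisfiesConditions.exactEquivalence (h : SatisfiesConditions e P) :
    (∃ h : ∀ X : E, isGP (End P) ((preadditiveCoyonedaObj P).obj X),
        IsExactEquivalence e (homGP P h)) ∧
      IsIwanagaGorenstein (End P) ∧ virdim (End P) ≤ (gldimMod E : WithBot ℕ∞) := by
  have hF := h.isFrobeniusGenerator
  have H := represents_coyoneda P
  have H' := represents_yoneda P
  have := h.idempotentComplete
  have := h.noetherian.1
  have := h.noetherian.2
  obtain ⟨d, hd⟩ := ENat.ne_top_iff_exists.1 h.gldim_lt.ne
  obtain ⟨d', hd'⟩ := ENat.ne_top_iff_exists.1 h.gldim_op_lt.ne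
  have hdim : injectiveDimension (rightRegular (End P)) ≤ d :=
    (injectiveDimension_le_iff _ _).2 (H.hasInjectiveDimensionLE hF hd.ge)
  -- The left injective dimension comes from `Hom(-, P)` on the opposite exact category.
  have hdim' : injectiveDimension (ModuleCat.of (End P) (End P)) ≤ d' :=
    (injectiveDimension_le_iff _ _).2 (H'.hasInjectiveDimensionLE hF.op hd'.ge)
  have hGP (X : E) : isGP (End P) ((preadditiveCoyonedaObj P).obj X) :=
    ⟨H.finite_obj hF X, H.extZero_obj hF X⟩
  have hlt (n : ℕ) : ((n : ℕ∞) : WithBot ℕ∞) < ⊤ := WithBot.coe_lt_coe.2 (ENat.natCast_lt_top n)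
  refine ⟨⟨hGP, ?_, fun T => ?_⟩, ⟨h.noetherian, hdim'.trans_lt (hlt _), hdim.trans_lt (hlt _)⟩, ?_⟩
  · have := (H.fullyFaithful hF).1
    have := (H.fullyFaithful hF).2
    refine { faithful := ?_, full := ?_, essSurj := ⟨fun M => ?_⟩ }
    · exact inferInstanceAs ((isGP (End P)).lift (preadditiveCoyonedaObj P) hGP).Faithful
    · exact inferInstanceAs ((isGP (End P)).lift (preadditiveCoyonedaObj P) hGP).Full
    · obtain ⟨h1, h2⟩ := (isGP_iff M.obj).1 M.property
      obtain ⟨X, ⟨φ⟩⟩ := H.exists_obj hF hd.ge M.obj h2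
      exact ⟨X, ⟨(isGP (End P)).isoMk φ.toModuleIso⟩⟩
  · rw [GP.conflation_homGP_iff]
    exact ⟨fun hT => ⟨H.map_injective hT, H.map_surjective hF.isProj ⟨_, _, _, hT⟩,
      H.map_exact hT⟩, fun ⟨h1, h2, h3⟩ => H.conflation_of_exact hF h1 h2 h3⟩
  · rw [← hd]
    exact hdim

end AddBiproduct

/-! ### Duality and reflexivity of Gorenstein projective modules -/

section Duality

variable {S T : Type v} [Ring S] [Ring T] {B : Type v} [AddCommGroup B] [Module S B] [Module T B]
  [SMulCommClass S T B]

theorem exists_factor_of_surjective {R : Type v} [Ring R] {U V W : Type v} [AddCommGroup U]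
    [AddCommGroup V] [AddCommGroup W] [Module R U] [Module R V] [Module R W] {r : U →ₗ[R] V}
    (hr : Function.Surjective r) (h : U →ₗ[R] W) (hrh : ∀ x, r x = 0 → h x = 0) :
    ∃ θ : V →ₗ[R] W, ∀ x, θ (r x) = h x := by
  refine ⟨(LinearMap.ker r).liftQ h hrh ∘ₗ (r.quotKerEquivOfSurjective hr).symm.toLinearMap,
    fun x => ?_⟩
  have : (r.quotKerEquivOfSurjective hr).symm (r x) = Submodule.Quotient.mk x := by
    rw [LinearEquiv.symm_apply_eq]; rfl
  simp only [LinearMap.comp_apply, LinearEquiv.coe_coe, this]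
  rfl

/-- Precomposition with an `S`-linear map, as a `T`-linear map. -/
def precomp {M N : Type v} [AddCommGroup M] [Module S M] [AddCommGroup N] [Module S N]
    (f : M →ₗ[S] N) : (N →ₗ[S] B) →ₗ[T] (M →ₗ[S] B) where
  toFun φ := φ ∘ₗ f
  map_add' _ _ := rfl
  map_smul' _ _ := rfl

variable {b : B} (hS : Function.Bijective fun s : S => s • b)
  (hT : Function.Bijective fun t : T => t • b)
include hS hT

omit hS in
theorem finite_projective_dual_free (n : ℕ) :
    Module.Finite T ((Fin n → S) →ₗ[S] B) ∧ Module.Projective T ((Fin n → S) →ₗ[S] B) := by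
  let E : T ≃ₗ[T] B := LinearEquiv.ofBijective (LinearMap.toSpanSingleton T _ b) hT
  have : Module.Free T B := Module.Free.of_equiv E
  have : Module.Finite T B := Module.Finite.equiv E
  let E' : ((Fin n → S) →ₗ[S] B) →ₗ[T] (Fin n → B) :=
    { toFun := fun φ k => φ (Pi.single k 1)
      map_add' := fun _ _ => rfl
      map_smul' := fun _ _ => rfl }
  have hE' : Function.Bijective E' := by
    refine ⟨fun φ ψ h => LinearMap.pi_ext' fun k => LinearMap.ext_ring (congrFun h k), fun y => ?_⟩
    refine ⟨∑ k, (LinearMap.toSpanSingleton S _ (y k)) ∘ₗ LinearMap.proj k, ?_⟩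
    ext j
    simp only [E', LinearMap.coe_mk, AddHom.coe_mk, LinearMap.sum_apply, LinearMap.comp_apply,
      LinearMap.proj_apply, LinearMap.toSpanSingleton_apply]
    rw [Finset.sum_eq_single j (fun k _ hk => by simp [Pi.single_eq_of_ne hk]) (by simp)]
    simp
  have E'' := (LinearEquiv.ofBijective E' hE').symm
  exact ⟨Module.Finite.equiv E'', Module.Projective.of_equiv E''⟩

omit [SMulCommClass S T B] hT in
theorem eq_zero_of_dual_free {n : ℕ} (y : Fin n → S)
    (hy : ∀ φ : (Fin n → S) →ₗ[S] B, φ y = 0) : y = 0 := by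
  ext k
  refine hS.1 ?_
  simpa using hy (LinearMap.toSpanSingleton S _ b ∘ₗ LinearMap.proj k)

/-- If `Ψ (p k) = s k • b` and `φ` sends the `k`-th basis vector to `t k • b`, then `φ = ∑ t k • p
k`. The two actions commute, so `Ψ φ = ∑ t k • s k • b` is the value of `φ` at `s`. -/
theorem exists_eq_eval_free {n : ℕ} (Ψ : ((Fin n → S) →ₗ[S] B) →ₗ[T] B) :
    ∃ y : Fin n → S, ∀ φ : (Fin n → S) →ₗ[S] B, Ψ φ = φ y := by
  let p (k : Fin n) : (Fin n → S) →ₗ[S] B := LinearMap.toSpanSingleton S _ b ∘ₗ LinearMap.proj k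
  choose s hs using fun k => hS.2 (Ψ (p k))
  simp only at hs
  refine ⟨s, fun φ => ?_⟩
  choose t ht using fun k => hT.2 (φ (Pi.single k 1))
  simp only at ht
  have h1 : φ = ∑ k, t k • p k := by
    refine LinearMap.pi_ext' fun j => LinearMap.ext_ring ?_
    simp only [p, LinearMap.comp_apply, LinearMap.single_apply, LinearMap.sum_apply,
      LinearMap.smul_apply, LinearMap.proj_apply, LinearMap.toSpanSingleton_apply]
    rw [Finset.sum_eq_single j (fun k _ hk => by simp [Pi.single_eq_of_ne hk]) (by simp)]
    simp [ht]
  rw [h1]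
  simp only [map_sum, map_smul, ← hs, LinearMap.sum_apply, LinearMap.smul_apply]
  refine Finset.sum_congr rfl fun k _ => ?_
  simp [p]

variable [IsNoetherianRing S]

omit hS hT [IsNoetherianRing S] in
/-- A presentation `K → S ^ n → M` of a Gorenstein projective module, and its dual. -/
theorem exists_syzygy (M : Type v) [AddCommGroup M] [Module S M] [Module.Finite S M]
    (hM : ExtZero S B 0 M) :
    ∃ (n : ℕ) (q : (Fin n → S) →ₗ[S] M), Function.Surjective q ∧
      ExtZero S B 0 (LinearMap.ker q) ∧
      Function.Injective (precomp (T := T) (B := B) q) ∧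
      Function.Surjective (precomp (T := T) (B := B) (LinearMap.ker q).subtype) ∧
      Function.Exact (precomp (T := T) (B := B) q)
        (precomp (T := T) (B := B) (LinearMap.ker q).subtype) := by
  obtain ⟨n, q, hq⟩ := Module.Finite.exists_fin' S M
  have hex := LinearMap.exact_subtype_ker_map q
  refine ⟨n, q, hq, (extZero_of_projective.shift Subtype.val_injective hq hex).1
    (hM.mono zero_le_one), fun φ ψ h => ?_, fun φ => ?_, fun φ => ⟨fun h => ?_, ?_⟩⟩
  · ext x
    obtain ⟨y, rfl⟩ := hq x
    exact LinearMap.congr_fun h y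
  · exact hM.extend Subtype.val_injective hq hex φ
  · obtain ⟨θ, hθ⟩ := exists_factor_of_surjective hq φ
      fun x hx => LinearMap.congr_fun h ⟨x, hx⟩
    exact ⟨θ, LinearMap.ext hθ⟩
  · rintro ⟨ψ, rfl⟩
    ext x
    exact (congrArg ψ x.2).trans (map_zero ψ)

omit [IsNoetherianRing S] hS in
theorem finite_dual [IsNoetherianRing T] (M : Type v) [AddCommGroup M] [Module S M] [Module.Finite S M] :
    Module.Finite T (M →ₗ[S] B) := by
  obtain ⟨n, q, hq⟩ := Module.Finite.exists_fin' S M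
  have := (finite_projective_dual_free (S := S) (B := B) hT n).1
  exact Module.Finite.of_injective (precomp (T := T) (B := B) q) fun φ ψ h => by
    ext x
    obtain ⟨y, rfl⟩ := hq x
    exact LinearMap.congr_fun h y

variable {d : ℕ} (hd : ∀ (N : Type v) [AddCommGroup N] [Module T N], ExtZero T B d N)
include hd

omit hS in
-- Dualizing `K → S ^ n → M` makes the dual of `M` a syzygy of the dual of `K`, and `K` is again
-- Gorenstein projective. After `d` rounds the dual of `M` is a `d`-th syzygy over `T`, which has no
-- positive Ext to `B` by `hd`.
theorem extZero_dual (M : Type v) [AddCommGroup M] [Module S M] [Module.Finite S M]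
    (hM : ExtZero S B 0 M) : ExtZero T B 0 (M →ₗ[S] B) := by
  suffices ∀ k ≤ d, ∀ (M : Type v) [AddCommGroup M] [Module S M] [Module.Finite S M],
      ExtZero S B 0 M → ExtZero T B (d - k) (M →ₗ[S] B) by
    simpa using this d le_rfl M hM
  intro k
  induction k with
  | zero => exact fun _ M _ _ _ _ => hd _
  | succ k ih =>
    intro hk M _ _ _ hM
    obtain ⟨n, q, hq, hK, h1, h2, h3⟩ := exists_syzygy (T := T) M hM
    have := ih (by omega) _ hK
    have hproj := (finite_projective_dual_free (S := S) (B := B) hT n).2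
    rw [show d - k = d - (k + 1) + 1 by omega] at this
    exact (extZero_of_projective.shift h1 h2 h3).1 this

/-- The dual of the syzygy has no positive Ext to `B`, so `Φ` extends to the dual of the free cover,
where functionals are evaluations. -/
theorem exists_eq_eval (M : Type v) [AddCommGroup M] [Module S M] [Module.Finite S M]
    (hM : ExtZero S B 0 M) (Φ : (M →ₗ[S] B) →ₗ[T] B) :
    ∃ x : M, ∀ φ : M →ₗ[S] B, Φ φ = φ x := by
  obtain ⟨n, q, hq, hK, h1, h2, h3⟩ := exists_syzygy (T := T) M hM
  obtain ⟨Ψ, rfl⟩ := (extZero_dual hT hd _ hK).extend h1 h2 h3 Φ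
  obtain ⟨y, hy⟩ := exists_eq_eval_free hS hT Ψ
  exact ⟨q y, fun φ => hy _⟩

/-- Write `x = q y`. Evaluation at `y` vanishes on the dual of `M`, so it factors through the dual
of the syzygy, where it is evaluation at some `z`. Maps to `B` separate points of the free module,
so `y = z` lies in the kernel of `q`. -/
theorem eq_zero_of_dual (M : Type v) [AddCommGroup M] [Module S M] [Module.Finite S M]
    (hM : ExtZero S B 0 M) (x : M) (hx : ∀ φ : M →ₗ[S] B, φ x = 0) : x = 0 := by
  obtain ⟨n, q, hq, hK, h1, h2, h3⟩ := exists_syzygy (T := T) M hM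
  obtain ⟨y, rfl⟩ := hq x
  let ev : ((Fin n → S) →ₗ[S] B) →ₗ[T] B :=
    { toFun := fun φ => φ y
      map_add' := fun _ _ => rfl
      map_smul' := fun _ _ => rfl }
  obtain ⟨θ, hθ⟩ := exists_factor_of_surjective h2 ev fun φ hφ => by
    obtain ⟨ψ, rfl⟩ := (h3 φ).1 hφ
    exact hx ψ
  obtain ⟨z, hz⟩ := exists_eq_eval hS hT hd _ hK θ
  have hyz : y - z = 0 := eq_zero_of_dual_free hS (y - z.1) fun φ => by
    have h5 : φ y = φ z := (hθ φ).symm.trans (hz _)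
    rw [map_sub, h5, sub_self]
  rw [sub_eq_zero.1 hyz]
  exact z.2

end Duality

/-- Gorenstein projective modules with respect to `B` embed into powers of `B` such that all maps
to `B` extend. -/
def HasEmbeddings (S : Type v) [Ring S] (B : Type v) [AddCommGroup B] [Module S B] : Prop :=
  ∀ (M : Type v) [AddCommGroup M] [Module S M], Module.Finite S M → ExtZero S B 0 M →
    ∃ (n : ℕ) (j : M →ₗ[S] (Fin n → B)), Function.Injective j ∧
      ∀ φ : M →ₗ[S] B, ∃ ψ : (Fin n → B) →ₗ[S] B, ψ ∘ₗ j = φ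

/-- Finitely many `T`-generators of the dual serve as coordinates. They separate points because the
dual does, and `∑ t k • p k` extends as `∑ t k • proj k`. -/
theorem hasEmbeddings {S T : Type v} [Ring S] [Ring T] {B : Type v} [AddCommGroup B]
    [Module S B] [Module T B] [SMulCommClass S T B] {b : B}
    (hS : Function.Bijective fun s : S => s • b) (hT : Function.Bijective fun t : T => t • b)
    [IsNoetherianRing S] [IsNoetherianRing T] {d : ℕ}
    (hd : ∀ (N : Type v) [AddCommGroup N] [Module T N], ExtZero T B d N) :
    HasEmbeddings S B := by
  intro M _ _ _ hM
  have : Module.Finite T (M →ₗ[S] B) := finite_dual hT M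
  obtain ⟨n, q, hq⟩ := Module.Finite.exists_fin' T (M →ₗ[S] B)
  let p (k : Fin n) : M →ₗ[S] B := q (Pi.single k 1)
  have hp (φ : M →ₗ[S] B) : ∃ t : Fin n → T, φ = ∑ k, t k • p k := by
    obtain ⟨t, rfl⟩ := hq φ
    refine ⟨t, ?_⟩
    simp only [p, ← map_smul, ← map_sum]
    congr 1
    ext j
    simp [Finset.sum_apply, Pi.single_apply]
  refine ⟨n, LinearMap.pi p, (injective_iff_map_eq_zero _).2 fun x hx => ?_, fun φ => ?_⟩
  · refine eq_zero_of_dual hS hT hd M hM x fun φ => ?_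
    obtain ⟨t, rfl⟩ := hp φ
    have (k : Fin n) : p k x = 0 := congrFun hx k
    simp [this]
  · obtain ⟨t, rfl⟩ := hp φ
    refine ⟨∑ k, t k • LinearMap.proj k, ?_⟩
    ext x
    simp

/-! ### Gorenstein projective approximations -/

section Approximation

variable {S : Type v} [Ring S] [IsNoetherianRing S] {B : Type v} [AddCommGroup B] [Module S B]
  [Module.Free S B] [Module.Finite S B]

/-- Right approximations of finitely generated modules by Gorenstein projective modules. -/
theorem exists_approximation (hB : HasEmbeddings S B) (n : ℕ) :
    ∀ (C : Type v) [AddCommGroup C] [Module S C] [Module.Finite S C], ExtZero S B n C →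
      ∃ (W : ModuleCat.{v} S) (w : W →ₗ[S] C), Module.Finite S W ∧ ExtZero S B 0 W ∧
        Function.Surjective w ∧ ∀ (X : Type v) [AddCommGroup X] [Module S X],
          Module.Finite S X → ExtZero S B 0 X → ∀ u : X →ₗ[S] C, ∃ l : X →ₗ[S] W, w ∘ₗ l = u := by
  induction n with
  | zero =>
    intro C _ _ _ hC
    exact ⟨ModuleCat.of S C, LinearMap.id, inferInstanceAs (Module.Finite S C), hC,
      Function.surjective_id, fun X _ _ _ _ u => ⟨u, rfl⟩⟩
  | succ n ih =>
    intro C _ _ _ hC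
    -- Approximate the kernel of a free cover by `G`, embed `G` in `B ^ k`, and divide `S ^ m × B ^
    -- k` by `G`. Extension of maps along `j` makes the quotient Gorenstein projective.
    obtain ⟨m, π, hπ⟩ := Module.Finite.exists_fin' S C
    obtain ⟨G, w, hGf, hG, hw, hlift⟩ := ih (LinearMap.ker π)
      ((extZero_of_projective.shift Subtype.val_injective hπ (LinearMap.exact_subtype_ker_map π)).1
        hC)
    obtain ⟨k, j, hj, hext⟩ := hB G hGf hG
    let ι : G →ₗ[S] (Fin m → S) × (Fin k → B) := ((LinearMap.ker π).subtype ∘ₗ w).prod j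
    have hι : Function.Injective ι := fun x y h => hj (congrArg Prod.snd h)
    have hW : ExtZero S B 0 (((Fin m → S) × (Fin k → B)) ⧸ LinearMap.range ι) :=
      hG.of_extend extZero_of_projective hι (Submodule.mkQ_surjective _)
        (LinearMap.exact_map_mkQ_range ι) fun φ => by
          obtain ⟨ψ, rfl⟩ := hext φ
          exact ⟨ψ ∘ₗ LinearMap.snd S _ _, rfl⟩
    let v : (((Fin m → S) × (Fin k → B)) ⧸ LinearMap.range ι) →ₗ[S] C :=
      (LinearMap.range ι).liftQ (π ∘ₗ LinearMap.fst S _ _) (by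
        rintro _ ⟨x, rfl⟩
        exact (w x).2)
    refine ⟨ModuleCat.of S (((Fin m → S) × (Fin k → B)) ⧸ LinearMap.range ι), v,
      inferInstanceAs (Module.Finite S (((Fin m → S) × (Fin k → B)) ⧸ LinearMap.range ι)), hW,
      fun c => ?_, fun X _ _ _ hX u => ?_⟩
    · obtain ⟨y, rfl⟩ := hπ c
      exact ⟨Submodule.Quotient.mk (y, 0), rfl⟩
    -- Lift `u` to `a` on a free cover of `X`. On the kernel, `a` factors through `G` as `a₀` by
    -- induction, and `j ∘ₗ a₀` extends to `c` on the cover because `X` is Gorenstein projective.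
    -- The pair `(a, c)` sends the kernel into the image of `G`, so it descends to `X`.
    · obtain ⟨r, π', hπ'⟩ := Module.Finite.exists_fin' S X
      have hex := LinearMap.exact_subtype_ker_map π'
      obtain ⟨a, ha⟩ := Module.projective_lifting_property π (u ∘ₗ π') hπ
      have ha' (y) : π (a y) = u (π' y) := LinearMap.congr_fun ha y
      obtain ⟨a₀, ha₀⟩ := hlift (LinearMap.ker π') inferInstance
        ((extZero_of_projective.shift Subtype.val_injective hπ' hex).1 (hX.mono zero_le_one))
        ((a ∘ₗ (LinearMap.ker π').subtype).codRestrict (LinearMap.ker π) fun y => by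
          have : π' y = 0 := y.2
          simp [ha', this])
      choose c hc using fun i : Fin k => hX.extend Subtype.val_injective hπ' hex
        (LinearMap.proj i ∘ₗ j ∘ₗ a₀)
      obtain ⟨l, hl⟩ := exists_factor_of_surjective hπ'
        ((LinearMap.range ι).mkQ ∘ₗ a.prod (LinearMap.pi c)) fun y hy => by
          refine (Submodule.Quotient.mk_eq_zero _).2 ⟨a₀ ⟨y, hy⟩, Prod.ext ?_ (funext fun i => ?_)⟩
          · exact congrArg Subtype.val (LinearMap.congr_fun ha₀ ⟨y, hy⟩)
          · exact (LinearMap.congr_fun (hc i) ⟨y, hy⟩).symm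
      refine ⟨l, LinearMap.ext fun x => ?_⟩
      obtain ⟨y, rfl⟩ := hπ' x
      exact (congrArg v (hl y)).trans (ha' y)

end Approximation

/-! ### Weak kernels and weak cokernels -/

section WeakKernels

variable {A : Type u} [Category.{v} A] [Preadditive A]

theorem hasWeakKernels_of_exists
    (h : ∀ (X Y : A) (f : X ⟶ Y), ∃ (Z : A) (k : Z ⟶ X), k ≫ f = 0 ∧
      ∀ (W : A) (a : W ⟶ X), a ≫ f = 0 → ∃ l : W ⟶ Z, l ≫ k = a) : HasWeakKernels A where
  hasWeakLimit {X Y} f := by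
    choose Z k w l hl using h
    exact HasWeakLimit.mk ⟨KernelFork.ofι (k _ _ f) (w _ _ f), Fork.IsWeakLimit.mk' _ fun s =>
      ⟨l _ _ f _ s.ι (KernelFork.condition s), hl _ _ f _ s.ι (KernelFork.condition s)⟩⟩

theorem hasWeakCokernels_of_op (h : HasWeakKernels Aᵒᵖ) : HasWeakCokernels A := by
  intro X Y f
  refine ⟨(weakKernel f.op).unop, (weakKernel.ι f.op).unop,
    congrArg Quiver.Hom.unop (weakKernel.condition f.op), fun W a ha => ?_⟩
  exact ⟨(weakKernel.lift f.op a.op (congrArg Quiver.Hom.op ha)).unop,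
    congrArg Quiver.Hom.unop (weakKernel.lift_ι f.op a.op (congrArg Quiver.Hom.op ha))⟩

end WeakKernels

/-! ### Epimorphisms and projectives in `mod A` -/

section FinitelyPresented

variable {A : Type u} [Category.{v} A] [Preadditive A]

omit [Preadditive A] in
theorem congr_app_apply {F F' : Aᵒᵖ ⥤ AddCommGrpCat.{v}} {α β : F ⟶ F'} (h : α = β) (W : A)
    (x : F.obj (.op W)) : (α.app (.op W)).hom x = (β.app (.op W)).hom x := by rw [h]

omit [Preadditive A] in
theorem shortExact_of_app {T : ShortComplex (Aᵒᵖ ⥤ AddCommGrpCat.{v})}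
    (h : ∀ W : A, Function.Injective (T.f.app (.op W)).hom ∧
      Function.Surjective (T.g.app (.op W)).hom ∧
      ∀ x, (T.g.app (.op W)).hom x = 0 → ∃ y, (T.f.app (.op W)).hom y = x) : T.ShortExact := by
  have hm (W) : Mono (T.f.app W) := (AddCommGrpCat.mono_iff_injective _).2 (h W.unop).1
  have he (W) : Epi (T.g.app W) := (AddCommGrpCat.epi_iff_surjective _).2 (h W.unop).2.1
  have : Mono T.f := NatTrans.mono_of_mono_app _
  have : Epi T.g := NatTrans.epi_of_epi_app _
  refine ⟨(ShortComplex.exact_iff_kernel_ι_comp_cokernel_π_zero T).2 ?_⟩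
  ext W x
  obtain ⟨y, hy⟩ := (h W.unop).2.2 (((kernel.ι T.g).app W).hom x)
    (congr_app_apply (kernel.condition T.g) W.unop x)
  change ((cokernel.π T.f).app W).hom (((kernel.ι T.g).app W).hom x) = 0
  rw [← hy]
  exact congr_app_apply (cokernel.condition T.f) W.unop y

theorem isFinPres_of_exact {X Y : A} {f : X ⟶ Y} {F : Aᵒᵖ ⥤ AddCommGrpCat.{v}}
    (ψ : preadditiveYoneda.obj Y ⟶ F) (hψ : ∀ W, Function.Surjective (evalAt ψ W))
    (h : ∀ (W : A) (a : W ⟶ Y), evalAt ψ W a = 0 ↔ ∃ b : W ⟶ X, b ≫ f = a) :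
    isFinPres A F := by
  have w : preadditiveYoneda.map f ≫ ψ = 0 := evalAt_ext (by
    rw [evalAt_map_comp, (h _ _).2 ⟨_, rfl⟩]; rfl)
  let δ := cokernel.desc _ ψ w
  have hδ {W : A} (a : W ⟶ Y) :
      (δ.app (.op W)).hom (evalAt (cokernel.π (preadditiveYoneda.map f)) W a) = evalAt ψ W a := by
    rw [← evalAt_comp_app, cokernel.π_desc]
  have (W : Aᵒᵖ) : IsIso (δ.app W) := by
    refine (ConcreteCategory.isIso_iff_bijective _).2
      ⟨(injective_iff_map_eq_zero (δ.app W).hom).2 fun x hx => ?_, fun y => ?_⟩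
    · obtain ⟨a, rfl⟩ := evalAt_cokernel_surjective f W.unop x
      rw [evalAt_cokernel_eq_zero, ← h]
      exact (hδ a).symm.trans hx
    · obtain ⟨a, rfl⟩ := hψ W.unop y
      exact ⟨_, hδ a⟩
  have : IsIso δ := NatIso.isIso_of_isIso_app _
  exact ⟨X, Y, f, ⟨(asIso δ).symm⟩⟩

theorem FunMod.exists_presentation (F : FunMod A) :
    ∃ (X Y : A) (f : X ⟶ Y) (ψ : preadditiveYoneda.obj Y ⟶ F.obj),
      (∀ W, Function.Surjective (evalAt ψ W)) ∧
        ∀ (W : A) (a : W ⟶ Y), evalAt ψ W a = 0 ↔ ∃ b : W ⟶ X, b ≫ f = a := by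
  obtain ⟨X, Y, f, ⟨φ⟩⟩ := F.property
  have hφ (W : A) : Function.Bijective (φ.inv.app (.op W)).hom :=
    ConcreteCategory.bijective_of_isIso (φ.inv.app (.op W))
  refine ⟨X, Y, f, cokernel.π _ ≫ φ.inv, fun W => ?_, fun W a => ?_⟩
  · exact (hφ W).2.comp (evalAt_cokernel_surjective f W)
  · rw [evalAt_comp_app, map_eq_zero_iff _ (hφ W).1, evalAt_cokernel_eq_zero]

variable [HasFiniteBiproducts A]

attribute [local instance] hasBinaryBiproducts_of_finite_biproducts

/-- The relations of the cokernel are those of `F'` together with the generators of `F`, lifted to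
`Y'`. -/
theorem isFinPres_cokernel {F F' : FunMod A} (p : F ⟶ F') : isFinPres A (cokernel p.hom) := by
  obtain ⟨X, Y, f, ψ, hψ, hf⟩ := F.exists_presentation
  obtain ⟨X', Y', f', ψ', hψ', hf'⟩ := F'.exists_presentation
  obtain ⟨c, hc⟩ := hψ' Y (evalAt (ψ ≫ p.hom) Y (𝟙 Y))
  have hc' : preadditiveYoneda.map c ≫ ψ' = ψ ≫ p.hom := evalAt_ext (by
    rw [evalAt_map_comp, Category.id_comp, hc])
  have hk {W : A} (x : F'.obj.obj (.op W)) : ((cokernel.π p.hom).app (.op W)).hom x = 0 ↔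
      ∃ y, (p.hom.app (.op W)).hom y = x :=
    (ShortComplex.ab_exact_iff_function_exact _).1
      ((ShortComplex.exact_cokernel p.hom).map ((evaluation _ _).obj (.op W))) x
  refine isFinPres_of_exact (f := biprod.desc c f') (ψ' ≫ cokernel.π p.hom)
    (fun W => (surjective_app_of_epi (cokernel.π p.hom) _).comp (hψ' W)) fun W a => ?_
  rw [evalAt_comp_app, hk]
  constructor
  · rintro ⟨y, hy⟩
    obtain ⟨b, rfl⟩ := hψ W y
    rw [← evalAt_comp_app, ← hc', evalAt_map_comp, eq_comm, ← sub_eq_zero, ← map_sub, hf'] at hy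
    obtain ⟨d, hd⟩ := hy
    exact ⟨biprod.lift b d, by simp [hd]⟩
  · rintro ⟨b, rfl⟩
    refine ⟨evalAt ψ W (b ≫ biprod.fst), ?_⟩
    rw [← evalAt_comp_app, ← hc', evalAt_map_comp, eq_comm, ← sub_eq_zero, ← map_sub, hf']
    exact ⟨b ≫ biprod.snd, by simp [biprod.desc_eq, Preadditive.comp_add]⟩

/-- The cokernel in the category of all functors is again in `mod A`, so it can be tested there. -/
theorem epi_hom_of_epi {F F' : FunMod A} (p : F ⟶ F') [Epi p] : Epi p.hom := by
  let q : F' ⟶ (⟨cokernel p.hom, isFinPres_cokernel p⟩ : FunMod A) :=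
    ObjectProperty.homMk (cokernel.π p.hom)
  have hq : p ≫ q = 0 := by
    ext1
    exact cokernel.condition p.hom
  have : q = 0 := zero_of_epi_comp p hq
  exact Abelian.epi_of_cokernel_π_eq_zero _ (congrArg InducedCategory.Hom.hom this)

instance projective_yonedaMod (X : A) : Projective (yonedaMod X) where
  factors {F F'} a p _ := by
    have := epi_hom_of_epi p
    obtain ⟨Y, Z, f, ψ, hψ, hf⟩ := F.exists_presentation
    obtain ⟨x, hx⟩ := surjective_app_of_epi p.hom _ (evalAt a.hom X (𝟙 X))
    obtain ⟨b, rfl⟩ := hψ X x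
    refine ⟨ObjectProperty.homMk (preadditiveYoneda.map b ≫ ψ), ?_⟩
    ext1
    refine evalAt_ext (Eq.trans ?_ hx)
    exact congrArg (fun t => (p.hom.app (.op X)).hom (evalAt ψ X t)) (Category.id_comp b)

end FinitelyPresented

/-- `G` is an equivalence onto the category of Gorenstein projective modules with respect to
`B`. -/
structure IsGPEquivalence {A : Type u} [Category.{v} A] {S : Type v} [Ring S]
    (G : A ⥤ ModuleCat.{v} S) (B : Type v) [AddCommGroup B] [Module S B] : Prop where
  full : G.Full
  faithful : G.Faithful
  finite : ∀ X, Module.Finite S (G.obj X)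
  extZero : ∀ X, ExtZero S B 0 (G.obj X)
  exists_obj : ∀ (M : Type v) [AddCommGroup M] [Module S M], Module.Finite S M →
    ExtZero S B 0 M → ∃ X : A, Nonempty (G.obj X ≃ₗ[S] M)

/-! ### Finite global dimension from approximations -/

section GlobalDimension

variable {A : Type u} [Category.{v} A] [Preadditive A] {S : Type v} [Ring S]
  {G : A ⥤ ModuleCat.{v} S} [G.Additive] {B : Type v} [AddCommGroup B] [Module S B]

omit [Preadditive A] [G.Additive] in
theorem IsGPEquivalence.exists_map (hG : IsGPEquivalence G B) {X Y : A}
    (φ : G.obj X →ₗ[S] G.obj Y) : ∃ f : X ⟶ Y, (G.map f).hom = φ := by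
  have := hG.full
  obtain ⟨f, hf⟩ := G.map_surjective (ModuleCat.ofHom φ)
  exact ⟨f, by rw [hf]; rfl⟩

omit [Preadditive A] [G.Additive] in
theorem IsGPEquivalence.map_inj (hG : IsGPEquivalence G B) {X Y : A} {f f' : X ⟶ Y}
    (h : ∀ x, (G.map f).hom x = (G.map f').hom x) : f = f' := by
  have := hG.faithful
  exact G.map_injective (by ext x; exact h x)

/-- The functor `Hom(G -, C)`. -/
def homFun (G : A ⥤ ModuleCat.{v} S) (C : Type v) [AddCommGroup C] [Module S C] :
    Aᵒᵖ ⥤ AddCommGrpCat.{v} :=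
  G.op ⋙ preadditiveYoneda.obj (ModuleCat.of S C)

variable {C D : Type v} [AddCommGroup C] [Module S C] [AddCommGroup D] [Module S D]

/-- The elements of `homFun G C` at `W` are linear maps. -/
def homFunEquiv (G : A ⥤ ModuleCat.{v} S) (C : Type v) [AddCommGroup C] [Module S C] (W : A) :
    (homFun G C).obj (.op W) ≃+ (G.obj W →ₗ[S] C) :=
  ModuleCat.homAddEquiv (M := G.obj W) (N := ModuleCat.of S C)

/-- The transformation induced by a linear map. -/
def homFunMap (G : A ⥤ ModuleCat.{v} S) (w : C →ₗ[S] D) : homFun G C ⟶ homFun G D :=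
  Functor.whiskerLeft G.op (preadditiveYoneda.map (ModuleCat.ofHom w))

omit [Preadditive A] [G.Additive] in
theorem homFunEquiv_homFunMap (w : C →ₗ[S] D) {W : A} (y : (homFun G C).obj (.op W)) :
    homFunEquiv G D W (((homFunMap G w).app (.op W)).hom y) = w ∘ₗ homFunEquiv G C W y := rfl

/-- The components of `toHomFun`. -/
def toHomFunApp {X : A} (l : G.obj X →ₗ[S] C) (W : A) :
    (W ⟶ X) →+ (homFun G C).obj (.op W) :=
  (homFunEquiv G C W).symm.toAddMonoidHom.comp
    (AddMonoidHom.mk' (fun a : W ⟶ X => l ∘ₗ (G.map a).hom)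
      fun a b => by rw [G.map_add, ModuleCat.hom_add, LinearMap.comp_add])

/-- The transformation to `Hom(G -, C)` given by an element of `Hom(G X, C)`. -/
def toHomFun {X : A} (l : G.obj X →ₗ[S] C) : preadditiveYoneda.obj X ⟶ homFun G C where
  app W := AddCommGrpCat.ofHom (toHomFunApp l W.unop)
  naturality W W' c := by
    ext a
    exact congrArg (fun t => t ≫ ModuleCat.ofHom l) (G.map_comp c.unop (show W.unop ⟶ X from a))

theorem homFunEquiv_toHomFun {X : A} (l : G.obj X →ₗ[S] C) {W : A} (a : W ⟶ X) :
    homFunEquiv G C W (evalAt (toHomFun l) W a) = l ∘ₗ (G.map a).hom := rfl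

theorem IsGPEquivalence.isIso_toHomFun (hG : IsGPEquivalence G B) {X : A} (l : G.obj X ≃ₗ[S] C) :
    IsIso (toHomFun (G := G) l.toLinearMap) := by
  have (W : Aᵒᵖ) : IsIso ((toHomFun (G := G) l.toLinearMap).app W) := by
    refine (ConcreteCategory.isIso_iff_bijective _).2
      ⟨fun a b h => hG.map_inj fun x => l.injective ?_, fun y => ?_⟩
    · exact LinearMap.congr_fun (congrArg (homFunEquiv G C W.unop) h) x
    · obtain ⟨f, hf⟩ := hG.exists_map (l.symm.toLinearMap ∘ₗ homFunEquiv G C W.unop y)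
      refine ⟨f, (homFunEquiv G C W.unop).injective ?_⟩
      refine (homFunEquiv_toHomFun l.toLinearMap f).trans ?_
      ext x
      simp [hf]
  exact NatIso.isIso_of_isIso_app _

variable [IsNoetherianRing S] [Module.Free S B] [Module.Finite S B]
  (hG : IsGPEquivalence G B) (hB : HasEmbeddings S B) {d : ℕ}
  (hd : ∀ (N : Type v) [AddCommGroup N] [Module S N], ExtZero S B d N)
include hG hB

omit [Preadditive A] [G.Additive] in
theorem IsGPEquivalence.exists_approximation {n : ℕ} (C : Type v) [AddCommGroup C] [Module S C]
    [Module.Finite S C] (hC : ExtZero S B n C) :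
    ∃ (Z : A) (w : G.obj Z →ₗ[S] C), Function.Surjective w ∧
      ∀ (X : A) (u : G.obj X →ₗ[S] C), ∃ l : X ⟶ Z, ∀ x, w ((G.map l).hom x) = u x := by
  obtain ⟨W, w, hWf, hW, hw, hl⟩ := Frob.exists_approximation hB n C hC
  obtain ⟨Z, ⟨φ⟩⟩ := hG.exists_obj W hWf hW
  refine ⟨Z, w ∘ₗ φ.toLinearMap, hw.comp φ.surjective, fun X u => ?_⟩
  obtain ⟨l, rfl⟩ := hl (G.obj X) (hG.finite X) (hG.extZero X) u
  obtain ⟨f, hf⟩ := hG.exists_map (φ.symm.toLinearMap ∘ₗ l)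
  exact ⟨f, fun x => by simp [hf]⟩

include hd

/-- Approximating the module kernel keeps the existence of factorizations, though not their
uniqueness. -/
theorem IsGPEquivalence.exists_weakKernel {X Y : A} (f : X ⟶ Y) :
    ∃ (Z : A) (k : Z ⟶ X), k ≫ f = 0 ∧ ∀ {W : A} (a : W ⟶ X), a ≫ f = 0 →
      ∃ l : W ⟶ Z, l ≫ k = a := by
  have := hG.finite X
  obtain ⟨Z, w, hw, hl⟩ := hG.exists_approximation hB (LinearMap.ker (G.map f).hom) (hd _)
  obtain ⟨k, hk⟩ := hG.exists_map ((LinearMap.ker (G.map f).hom).subtype ∘ₗ w)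
  refine ⟨Z, k, hG.map_inj fun x => ?_, fun {W} a ha => ?_⟩
  · rw [map_comp_apply, hk, map_zero_apply]
    exact (w x).2
  · obtain ⟨l, h⟩ := hl W ((G.map a).hom.codRestrict _ fun x => by
      rw [LinearMap.mem_ker, ← map_comp_apply, ha, map_zero_apply])
    refine ⟨l, hG.map_inj fun x => ?_⟩
    rw [map_comp_apply, hk]
    exact congrArg Subtype.val (h x)

theorem IsGPEquivalence.isFinPres_homFun (C : Type v) [AddCommGroup C] [Module S C]
    [Module.Finite S C] : isFinPres A (homFun G C) := by
  obtain ⟨Z, w, hw, hl⟩ := hG.exists_approximation hB C (hd C)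
  have := hG.finite Z
  obtain ⟨Z', w', hw', hl'⟩ := hG.exists_approximation hB (LinearMap.ker w) (hd _)
  obtain ⟨f, hf⟩ := hG.exists_map ((LinearMap.ker w).subtype ∘ₗ w')
  refine isFinPres_of_exact (f := f) (toHomFun w) (fun W y => ?_) fun W a => ?_
  · obtain ⟨l, h⟩ := hl W (homFunEquiv G C W y)
    exact ⟨l, (homFunEquiv G C W).injective (LinearMap.ext h)⟩
  · rw [← (homFunEquiv G C W).map_eq_zero_iff, homFunEquiv_toHomFun]
    constructor
    · intro h
      obtain ⟨b, hb⟩ := hl' W ((G.map a).hom.codRestrict (LinearMap.ker w) (LinearMap.congr_fun h))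
      refine ⟨b, hG.map_inj fun x => ?_⟩
      rw [map_comp_apply, hf]
      exact congrArg Subtype.val (hb x)
    · rintro ⟨b, rfl⟩
      ext x
      rw [LinearMap.comp_apply, map_comp_apply, hf]
      exact (w' _).2

variable [HasFiniteBiproducts A]

/-- Maps from modules `G.obj W` lift along the approximation, so `0 → Hom(G -, ker w) → Hom(G -, G
Z) → Hom(G -, C) → 0` is exact. The middle term is representable, and the Ext bound of `ker w` is
one lower. -/
theorem IsGPEquivalence.hasProjDimLE_homFun {n : ℕ} :
    ∀ (C : Type v) [AddCommGroup C] [Module S C] [Module.Finite S C], ExtZero S B n C →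
      ∀ F : FunMod A, (homFun G C ≅ F.obj) → FunMod.HasProjDimLE n F := by
  induction n with
  | zero =>
    intro C _ _ _ hC F φ
    obtain ⟨X, ⟨l⟩⟩ := hG.exists_obj C inferInstance hC
    have := hG.isIso_toHomFun l
    exact Projective.of_iso (P := yonedaMod X)
      ((isFinPres A).isoMk (asIso (toHomFun (G := G) l.toLinearMap) ≪≫ φ)) inferInstance
  | succ n ih =>
    intro C _ _ _ hC F φ
    obtain ⟨Z, w, hw, hl⟩ := hG.exists_approximation hB C hC
    have := hG.finite Z
    have hK : ExtZero S B n (LinearMap.ker w) :=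
      ((hG.extZero Z).shift Subtype.val_injective hw (LinearMap.exact_subtype_ker_map w)).1 hC
    have := hG.isIso_toHomFun (LinearEquiv.refl S (G.obj Z))
    let F₁ : FunMod A := ⟨homFun G (LinearMap.ker w), hG.isFinPres_homFun hB hd _⟩
    let F₂ : FunMod A := ⟨homFun G (G.obj Z), hG.isFinPres_homFun hB hd _⟩
    let i : F₁ ⟶ F₂ := ObjectProperty.homMk (homFunMap G (LinearMap.ker w).subtype)
    let p : F₂ ⟶ F := ObjectProperty.homMk (homFunMap G w ≫ φ.hom)
    have hφ (W : A) : Function.Bijective (φ.hom.app (.op W)).hom :=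
      ConcreteCategory.bijective_of_isIso (φ.hom.app (.op W))
    have hip : homFunMap G (LinearMap.ker w).subtype ≫ homFunMap G w = 0 := by
      ext W y
      refine (homFunEquiv G C W.unop).injective ?_
      ext x
      exact (homFunEquiv G (LinearMap.ker w) W.unop y x).2
    have hip' : i ≫ p = 0 := by
      ext1
      change homFunMap G (LinearMap.ker w).subtype ≫ homFunMap G w ≫ φ.hom = 0
      rw [reassoc_of% hip, zero_comp]
    refine ⟨ShortComplex.mk i p hip', shortExact_of_app fun W => ⟨fun y y' h => ?_, fun y => ?_,
      fun y hy => ?_⟩, ?_, ⟨Iso.refl _⟩, ih _ hK F₁ (Iso.refl _)⟩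
    · refine (homFunEquiv G (LinearMap.ker w) W).injective (LinearMap.ext fun x => Subtype.ext ?_)
      exact LinearMap.congr_fun (congrArg (homFunEquiv G (G.obj Z) W) h) x
    · obtain ⟨y, rfl⟩ := (hφ W).2 y
      obtain ⟨l, hl⟩ := hl W (homFunEquiv G C W y)
      refine ⟨(homFunEquiv G (G.obj Z) W).symm (G.map l).hom, congrArg (φ.hom.app (.op W)).hom ?_⟩
      exact (homFunEquiv G C W).injective (LinearMap.ext hl)
    · have h1 : ((homFunMap G w).app (.op W)).hom y = 0 :=
        (hφ W).1 (Eq.trans hy (map_zero _).symm)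
      have h2 : w ∘ₗ homFunEquiv G (G.obj Z) W y = 0 :=
        (homFunEquiv_homFunMap w y).symm.trans ((congrArg _ h1).trans (map_zero _))
      refine ⟨(homFunEquiv G (LinearMap.ker w) W).symm
        ((homFunEquiv G (G.obj Z) W y).codRestrict _ (LinearMap.congr_fun h2)), ?_⟩
      exact (homFunEquiv G (G.obj Z) W).injective rfl
    · exact Projective.of_iso (P := yonedaMod Z) ((isFinPres A).isoMk
        (asIso (toHomFun (G := G) (LinearEquiv.refl S (G.obj Z)).toLinearMap))) inferInstance

/-- The presentation by `f : X ⟶ Y` accounts for two steps. The next syzygy is `Hom(G -, ker (G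
f))`, of projective dimension at most `d`. -/
theorem IsGPEquivalence.hasProjDimLE (F : FunMod A) : FunMod.HasProjDimLE (d + 2) F := by
  obtain ⟨X, Y, f, ψ, hψ, hf⟩ := F.exists_presentation
  obtain ⟨Z, k, hkf, hk⟩ := hG.exists_weakKernel hB hd f
  have hw : preadditiveYoneda.map f ≫ ψ = 0 := evalAt_ext (by
    rw [evalAt_map_comp, (hf _ _).2 ⟨_, rfl⟩]; rfl)
  let κ := kernel.lift ψ (preadditiveYoneda.map f) hw
  have hκι {W : A} (a : W ⟶ X) :
      ((kernel.ι ψ).app (.op W)).hom (evalAt κ W a) = (a ≫ f : W ⟶ Y) := by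
    rw [← evalAt_comp_app, kernel.lift_ι]; rfl
  have hιinj (W : A) : Function.Injective ((kernel.ι ψ).app (.op W)).hom :=
    (AddCommGrpCat.mono_iff_injective _).1 inferInstance
  have hκ (W : A) : Function.Surjective (evalAt κ W) := fun y => by
    have : evalAt ψ W (((kernel.ι ψ).app (.op W)).hom y : W ⟶ Y) = 0 :=
      congr_app_apply (kernel.condition ψ) W y
    obtain ⟨b, hb⟩ := (hf _ _).1 this
    exact ⟨b, hιinj W ((hκι b).trans hb)⟩
  have hκ0 {W : A} (a : W ⟶ X) : evalAt κ W a = 0 ↔ a ≫ f = 0 := by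
    rw [← map_eq_zero_iff _ (hιinj W), hκι]; rfl
  -- The first syzygy is finitely presented because `f` has a weak kernel.
  let I : FunMod A := ⟨kernel ψ, isFinPres_of_exact (f := k) κ hκ fun W a => by
    rw [hκ0]
    exact ⟨hk a, by rintro ⟨b, rfl⟩; rw [Category.assoc, hkf, comp_zero]⟩⟩
  have := hG.finite X
  have := hG.isIso_toHomFun (LinearEquiv.refl S (G.obj X))
  let τ := toHomFun (G := G) (LinearEquiv.refl S (G.obj X)).toLinearMap
  have hτ (W : A) : Function.Bijective (evalAt τ W) :=
    ConcreteCategory.bijective_of_isIso (τ.app (.op W))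
  let F₁ : FunMod A := ⟨homFun G (LinearMap.ker (G.map f).hom), hG.isFinPres_homFun hB hd _⟩
  let F₂ : FunMod A := ⟨homFun G (G.obj X), hG.isFinPres_homFun hB hd _⟩
  let i : F₁ ⟶ F₂ := ObjectProperty.homMk (homFunMap G (LinearMap.ker (G.map f).hom).subtype)
  let p : F₂ ⟶ I := ObjectProperty.homMk (inv τ ≫ κ)
  have hp {W : A} (a : W ⟶ X) : (p.hom.app (.op W)).hom (evalAt τ W a) = evalAt κ W a := by
    have : τ ≫ p.hom = κ := IsIso.hom_inv_id_assoc τ κ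
    rw [← evalAt_comp_app, this]
  have hp0 {W : A} (y : (homFun G (G.obj X)).obj (.op W)) : (p.hom.app (.op W)).hom y = 0 ↔
      (G.map f).hom ∘ₗ homFunEquiv G (G.obj X) W y = 0 := by
    obtain ⟨a, rfl⟩ := (hτ W).2 y
    rw [hp, hκ0]
    constructor
    · intro h
      ext x
      change (G.map f).hom ((G.map a).hom x) = 0
      rw [← map_comp_apply, h, map_zero_apply]
    · intro h
      refine hG.map_inj fun x => ?_
      rw [map_comp_apply, map_zero_apply]
      exact LinearMap.congr_fun h x
  have hip : i ≫ p = 0 := by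
    ext W y
    refine (hp0 (W := W.unop) _).2 (LinearMap.ext fun x => ?_)
    exact (homFunEquiv G (LinearMap.ker (G.map f).hom) W.unop y x).2
  let j : I ⟶ yonedaMod Y := ObjectProperty.homMk (kernel.ι ψ)
  let q : yonedaMod Y ⟶ F := ObjectProperty.homMk ψ
  have hjq : j ≫ q = 0 := by
    ext1
    exact kernel.condition ψ
  refine ⟨ShortComplex.mk j q hjq, shortExact_of_app fun W => ⟨hιinj W, hψ W, fun y hy => ?_⟩,
    projective_yonedaMod Y, ⟨Iso.refl _⟩, ShortComplex.mk i p hip,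
    shortExact_of_app fun W => ⟨fun y y' h => ?_, fun y => ?_, fun y hy => ?_⟩, ?_, ⟨Iso.refl _⟩,
    hG.hasProjDimLE_homFun hB hd _ (hd _) F₁ (Iso.refl _)⟩
  · obtain ⟨b, hb⟩ := (hf W y).1 hy
    exact ⟨evalAt κ W b, (hκι b).trans hb⟩
  · refine (homFunEquiv G (LinearMap.ker (G.map f).hom) W).injective
      (LinearMap.ext fun x => Subtype.ext ?_)
    exact LinearMap.congr_fun (congrArg (homFunEquiv G (G.obj X) W) h) x
  · obtain ⟨a, rfl⟩ := hκ W y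
    exact ⟨_, hp a⟩
  · refine ⟨(homFunEquiv G (LinearMap.ker (G.map f).hom) W).symm
      ((homFunEquiv G (G.obj X) W y).codRestrict _ (LinearMap.congr_fun ((hp0 y).1 hy))), ?_⟩
    exact (homFunEquiv G (G.obj X) W).injective rfl
  · exact Projective.of_iso (P := yonedaMod X) ((isFinPres A).isoMk (asIso τ)) inferInstance

theorem IsGPEquivalence.gldimMod_lt_top : gldimMod A < ⊤ :=
  lt_of_le_of_lt (iSup_le fun F => iInf₂_le (d + 2) (hG.hasProjDimLE hB hd F))
    (ENat.natCast_lt_top _)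

end GlobalDimension

/-! ### Inflations, deflations and idempotents via Gorenstein projective modules -/

section Frobenius

variable {A : Type u} [Category.{v} A] [Preadditive A] [HasFiniteBiproducts A]
  {e : ExactStructure A} {S : Type v} [Ring S] {G : A ⥤ ModuleCat.{v} S} [G.Additive]
  {P : A} {g : G.obj P} (H : Represents G P g) {B : Type v} [AddCommGroup B] [Module S B]
  (hG : IsGPEquivalence G B)
  (hc : ∀ T : ShortComplex A, e.conflation T ↔ Function.Injective (G.map T.f).hom ∧
    Function.Surjective (G.map T.g).hom ∧ Function.Exact (G.map T.f).hom (G.map T.g).hom)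

omit [Preadditive A] [G.Additive] [HasFiniteBiproducts A] in
include hG in
theorem IsGPEquivalence.isIdempotentComplete : IsIdempotentComplete A where
  idempotents_split X p hp := by
    let π : G.obj X →ₗ[S] G.obj X := (G.map p).hom
    have hπ (x) : π (π x) = π x := by
      change (G.map p).hom ((G.map p).hom x) = (G.map p).hom x
      rw [← map_comp_apply, hp]
    let r : G.obj X →ₗ[S] LinearMap.range π := π.rangeRestrict
    have hr (x : LinearMap.range π) : r x.1 = x := by
      obtain ⟨_, y, rfl⟩ := x
      exact Subtype.ext (hπ y)
    have := hG.finite X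
    obtain ⟨Y, ⟨φ⟩⟩ := hG.exists_obj (LinearMap.range π)
      (Module.Finite.of_surjective r π.surjective_rangeRestrict)
      ((hG.extZero X).of_retract (LinearMap.range π).subtype r hr)
    obtain ⟨i, hi⟩ := hG.exists_map ((LinearMap.range π).subtype ∘ₗ φ.toLinearMap)
    obtain ⟨q, hq⟩ := hG.exists_map (φ.symm.toLinearMap ∘ₗ r)
    refine ⟨Y, i, q, hG.map_inj fun x => ?_, hG.map_inj fun x => ?_⟩
    · rw [map_comp_apply, hi, hq]
      simp [hr]
    · rw [map_comp_apply, hi, hq]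
      simp [r, π]

include hc

omit [G.Additive] in
include H in
theorem Represents.isProj : e.IsProj P := by
  rintro Y Z p ⟨X, f, w, h⟩ a
  obtain ⟨y, hy⟩ := ((hc _).1 h).2.1 ((G.map a).hom g)
  obtain ⟨b, rfl⟩ := H.exists_hom y
  exact ⟨b, H.hom_ext (by rw [map_comp_apply]; exact hy)⟩

include hG

omit [HasFiniteBiproducts A] hc in
theorem IsGPEquivalence.exact_comp_eq_zero {X Y Z : A} {i : X ⟶ Y} {p : Y ⟶ Z}
    (h : Function.Exact (G.map i).hom (G.map p).hom) : i ≫ p = 0 :=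
  hG.map_inj fun x => by rw [map_comp_apply, map_zero_apply, h.apply_apply_eq_zero]

theorem IsGPEquivalence.isDeflation [IsNoetherianRing S] {Y Z : A} (p : Y ⟶ Z)
    (hp : Function.Surjective (G.map p).hom) : IsDeflation e.conflation p := by
  have := hG.finite Y
  have hex := LinearMap.exact_subtype_ker_map (G.map p).hom
  obtain ⟨X, ⟨φ⟩⟩ := hG.exists_obj (LinearMap.ker (G.map p).hom) inferInstance
    (((hG.extZero Y).shift Subtype.val_injective hp hex).1 ((hG.extZero Z).mono zero_le_one))
  obtain ⟨i, hi⟩ := hG.exists_map ((LinearMap.ker (G.map p).hom).subtype ∘ₗ φ.toLinearMap)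
  have hi' : Function.Exact (G.map i).hom (G.map p).hom := by
    intro y
    rw [hi, hex y]
    simp
  refine ⟨X, i, hG.exact_comp_eq_zero hi', (hc _).2 ⟨?_, hp, hi'⟩⟩
  simp only [hi]
  exact Subtype.val_injective.comp φ.injective

/-- Extension of maps to `B` is what makes the cokernel Gorenstein projective; injectivity alone
would not. -/
theorem IsGPEquivalence.isInflation {X Y : A} (i : X ⟶ Y)
    (hi : Function.Injective (G.map i).hom)
    (hext : ∀ φ : G.obj X →ₗ[S] B, ∃ ψ : G.obj Y →ₗ[S] B, ψ ∘ₗ (G.map i).hom = φ) :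
    IsInflation e.conflation i := by
  have := hG.finite Y
  have hex := LinearMap.exact_map_mkQ_range (G.map i).hom
  obtain ⟨Z, ⟨φ⟩⟩ := hG.exists_obj (G.obj Y ⧸ LinearMap.range (G.map i).hom) inferInstance
    ((hG.extZero X).of_extend (hG.extZero Y) hi (Submodule.mkQ_surjective _) hex hext)
  obtain ⟨p, hp⟩ := hG.exists_map (φ.symm.toLinearMap ∘ₗ (LinearMap.range (G.map i).hom).mkQ)
  have hp' : Function.Exact (G.map i).hom (G.map p).hom := by
    intro y
    rw [hp, ← hex y]
    simp
  refine ⟨Z, p, hG.exact_comp_eq_zero hp', (hc _).2 ⟨hi, ?_, hp'⟩⟩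
  simp only [hp]
  exact φ.symm.surjective.comp (Submodule.mkQ_surjective _)

include H

theorem IsGPEquivalence.exists_deflation [IsNoetherianRing S] (X : A) :
    ∃ (n : ℕ) (p : (⨁ fun _ : Fin n => P) ⟶ X), IsDeflation e.conflation p := by
  have := hG.finite X
  obtain ⟨n, q, hq⟩ := H.exists_cover_module (G.obj X)
  obtain ⟨p, rfl⟩ := hG.exists_map q
  exact ⟨n, p, hG.isDeflation hc p hq⟩

end Frobenius

/-! ### `P` as a Frobenius generator -/

section FrobeniusGenerator

variable {A : Type u} [Category.{v} A] [Preadditive A] [HasFiniteBiproducts A]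
  {e : ExactStructure A} {S : Type v} [Ring S] {G : A ⥤ ModuleCat.{v} S}
  [G.Additive] {P : A} {g : G.obj P} (H : Represents G P g) (hG : IsGPEquivalence G (G.obj P))
  (hc : ∀ T : ShortComplex A, e.conflation T ↔ Function.Injective (G.map T.f).hom ∧
    Function.Surjective (G.map T.g).hom ∧ Function.Exact (G.map T.f).hom (G.map T.g).hom)

omit [G.Additive] in
include hG hc in
theorem IsGPEquivalence.isInj : e.IsInj P := by
  rintro X Y i ⟨Z, p, w, h⟩ a
  obtain ⟨h1, h2, h3⟩ := (hc _).1 h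
  obtain ⟨ψ, hψ⟩ := (hG.extZero Z).extend h1 h2 h3 (G.map a).hom
  obtain ⟨b, rfl⟩ := hG.exists_map ψ
  exact ⟨b, hG.map_inj fun x => by rw [map_comp_apply, ← hψ]; rfl⟩

include hG hc in
theorem IsGPEquivalence.exists_inflation (hB : HasEmbeddings S (G.obj P)) (X : A) :
    ∃ (n : ℕ) (i : X ⟶ ⨁ fun _ : Fin n => P), IsInflation e.conflation i := by
  obtain ⟨n, j, hj, hext⟩ := hB (G.obj X) (hG.finite X) (hG.extZero X)
  choose f hf using fun k => hG.exists_map (LinearMap.proj k ∘ₗ j)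
  have hf' (k) (x : G.obj X) : (G.map (biproduct.π (fun _ : Fin n => P) k)).hom
      ((G.map (biproduct.lift f)).hom x) = j x k := by
    rw [← map_comp_apply, biproduct.lift_π, hf]; rfl
  refine ⟨n, biproduct.lift f, hG.isInflation hc _ (fun x y h => hj (funext fun k => ?_))
    fun φ => ?_⟩
  · rw [← hf', ← hf', h]
  · obtain ⟨ψ, rfl⟩ := hext φ
    refine ⟨ψ ∘ₗ LinearMap.pi fun k => (G.map (biproduct.π (fun _ : Fin n => P) k)).hom, ?_⟩
    ext x
    exact congrArg ψ (funext fun k => hf' k x)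

include H hG hc in
theorem IsGPEquivalence.isFrobeniusGenerator [IsNoetherianRing S] (hB : HasEmbeddings S (G.obj P)) :
    e.IsFrobeniusGenerator P where
  isProj := H.isProj hc
  isInj := hG.isInj hc
  cover X := by
    obtain ⟨n, p, hp⟩ := hG.exists_deflation H hc X
    exact ⟨_, p, addIn_biproduct n P, hp⟩
  cocover X := by
    obtain ⟨n, i, hi⟩ := hG.exists_inflation hc hB X
    exact ⟨_, i, addIn_biproduct n P, hi⟩

end FrobeniusGenerator

/-! ### Projectives, injectives and `add P` -/

section Frobenius

variable {A : Type u} [Category.{v} A] [Preadditive A] [HasFiniteBiproducts A]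
  {e : ExactStructure A} {P : A}

theorem AddIn.isProj (hP : e.IsProj P) {Q : A} (hQ : AddIn P Q) : e.IsProj Q := by
  obtain ⟨n, π, ι, h⟩ := hQ
  intro Y Z p hp f
  choose l hl using fun k => hP p hp (ι k ≫ f)
  refine ⟨∑ k, π k ≫ l k, ?_⟩
  simp only [Preadditive.sum_comp, Category.assoc, hl]
  exact (eq_sum_comp h f).symm

theorem AddIn.isInj (hP : e.IsInj P) {Q : A} (hQ : AddIn P Q) : e.IsInj Q := by
  obtain ⟨n, π, ι, h⟩ := hQ
  intro Y Z i hi f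
  choose l hl using fun k => hP i hi (f ≫ π k)
  refine ⟨∑ k, l k ≫ ι k, ?_⟩
  simp only [Preadditive.comp_sum, reassoc_of% hl]
  rw [← Preadditive.comp_sum, h, Category.comp_id]

omit [HasFiniteBiproducts A] in
theorem AddIn.of_retract {Q X : A} (hQ : AddIn P Q) (s : X ⟶ Q) (r : Q ⟶ X) (h : s ≫ r = 𝟙 X) :
    AddIn P X := by
  obtain ⟨n, π, ι, hQ⟩ := hQ
  refine ⟨n, fun k => s ≫ π k, fun k => ι k ≫ r, ?_⟩
  rw [← h]
  nth_rewrite 2 [eq_sum_comp hQ r]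
  simp only [Preadditive.comp_sum, Category.assoc]

theorem ExactStructure.IsFrobeniusGenerator.isProj_iff (hF : e.IsFrobeniusGenerator P) (X : A) :
    e.IsProj X ↔ AddIn P X := by
  refine ⟨fun hX => ?_, AddIn.isProj hF.isProj⟩
  obtain ⟨Q, p, hQ, hp⟩ := hF.cover X
  obtain ⟨s, hs⟩ := hX p hp (𝟙 X)
  exact hQ.of_retract s p hs

theorem ExactStructure.IsFrobeniusGenerator.isInj_iff (hF : e.IsFrobeniusGenerator P) (X : A) :
    e.IsInj X ↔ AddIn P X := by
  refine ⟨fun hX => ?_, AddIn.isInj hF.isInj⟩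
  obtain ⟨Q, i, hQ, hi⟩ := hF.cocover X
  obtain ⟨r, hr⟩ := hX i hi (𝟙 X)
  exact hQ.of_retract i r hr

theorem ExactStructure.IsFrobeniusGenerator.isFrobenius (hF : e.IsFrobeniusGenerator P) :
    e.IsFrobenius where
  enoughProj X := by
    obtain ⟨Q, p, hQ, hp⟩ := hF.cover X
    exact ⟨Q, p, hQ.isProj hF.isProj, hp⟩
  enoughInj X := by
    obtain ⟨Q, p, hQ, hp⟩ := hF.cocover X
    exact ⟨Q, p, hQ.isInj hF.isInj, hp⟩
  proj_iff_inj X := (hF.isProj_iff X).trans (hF.isInj_iff X).symm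

attribute [local instance] hasBinaryBiproducts_of_finite_biproducts

/-- A deflation onto a projective splits, and its kernel is the required complement, so no
idempotent has to be split. -/
theorem isInAdd_of_isProj {n : ℕ} {X : A} (hX : e.IsProj X) (p : (⨁ fun _ : Fin n => P) ⟶ X)
    (hp : IsDeflation e.conflation p) : IsInAdd P X := by
  obtain ⟨s, hs⟩ := hX p hp (𝟙 X)
  obtain ⟨K, k, w, h⟩ := hp
  obtain ⟨r, hr⟩ := e.exists_lift h (𝟙 _ - p ≫ s) (by simp [Preadditive.sub_comp, hs])
  have := e.mono_f h
  simp only at r hr this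
  have hkr : k ≫ r = 𝟙 K := by
    rw [← cancel_mono k, Category.assoc, hr]
    simp [Preadditive.comp_sub, reassoc_of% w]
  have hsr : s ≫ r = 0 := by
    rw [← cancel_mono k, Category.assoc, hr]
    simp [Preadditive.comp_sub, reassoc_of% hs]
  refine ⟨n, K, ⟨⟨biprod.desc s k, biprod.lift p r, ?_, ?_⟩⟩⟩
  · apply biprod.hom_ext'
    · apply biprod.hom_ext <;> simp [hs, hsr]
    · apply biprod.hom_ext <;> simp [w, hkr]
  · rw [biprod.lift_desc, hr]
    simp

end Frobenius

/-! ### Gorenstein projective left modules as `Hom(X, P)` -/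

section Reflexivity

theorem bijective_smul_one (R : Type v) [Ring R] : Function.Bijective fun s : R => s • (1 : R) :=
  ⟨fun a b h => by simpa using h, fun a => ⟨a, mul_one a⟩⟩

theorem bijective_op_smul_one (R : Type v) [Ring R] :
    Function.Bijective fun s : Rᵐᵒᵖ => s • (1 : R) :=
  ⟨fun a b h => by simpa using h, fun a => ⟨.op a, one_mul a⟩⟩

variable {E : Type u} [Category.{v} E] [Preadditive E] (P : E)

/-- If every Gorenstein projective right module over `End P` is of the form `Hom(P, X)`, then every
Gorenstein projective left module is of the form `Hom(X, P)`. -/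
theorem exists_yoneda_equiv [IsNoetherianRing (End P)] [IsNoetherianRing (End P)ᵐᵒᵖ]
    (hG : IsGPEquivalence (preadditiveCoyonedaObj P) ((preadditiveCoyonedaObj P).obj P)) {d : ℕ}
    (hd : ∀ (N : Type v) [AddCommGroup N] [Module (End P)ᵐᵒᵖ N],
      ExtZero (End P)ᵐᵒᵖ (End P) d N)
    (M : Type v) [AddCommGroup M] [Module (End P) M] [Module.Finite (End P) M]
    (hM : ExtZero (End P) (End P) 0 M) :
    ∃ X : E, Nonempty ((preadditiveYonedaObj P).obj (.op X) ≃ₗ[End P] M) := by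
  have hS := bijective_smul_one (End P)
  have hT := bijective_op_smul_one (End P)
  -- Choose `X` with `Hom(P, X)` isomorphic to the dual of `M`. Evaluation at `m` is then a linear
  -- map `Hom(P, X) → Hom(P, P)`, hence composition with some `f m : X ⟶ P`.
  obtain ⟨X, ⟨φ⟩⟩ := hG.exists_obj (M →ₗ[End P] End P) (finite_dual hT M) (extZero_dual hT hd M hM)
  let ev (m : M) : (P ⟶ X) →ₗ[(End P)ᵐᵒᵖ] (P ⟶ P) :=
    { toFun := fun a => φ a m
      map_add' := fun a b => LinearMap.congr_fun (map_add φ a b) m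
      map_smul' := fun r a => LinearMap.congr_fun (map_smul φ r a) m }
  have hex (m : M) : ∃ f : X ⟶ P, ∀ a : P ⟶ X, a ≫ f = φ a m := by
    obtain ⟨f, hf⟩ := hG.exists_map (X := X) (Y := P) (ev m)
    exact ⟨f, fun a => LinearMap.congr_fun hf a⟩
  choose f hf using hex
  have hinj {a b : X ⟶ P} (h : ∀ c : P ⟶ X, c ≫ a = c ≫ b) : a = b := hG.map_inj h
  let ε : M →ₗ[End P] (X ⟶ P) :=
    { toFun := f
      map_add' := fun m m' => hinj fun c => by
        rw [hf, map_add, Preadditive.comp_add, hf, hf]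
      map_smul' := fun r m => hinj fun c => by
        rw [hf, map_smul]
        change _ = c ≫ f m ≫ r
        rw [reassoc_of% hf m c]
        rfl }
  refine ⟨X, ⟨(LinearEquiv.ofBijective ε ⟨?_, fun y => ?_⟩).symm⟩⟩
  · refine (injective_iff_map_eq_zero ε).2 fun m hm => eq_zero_of_dual hS hT hd M hM m fun ψ => ?_
    obtain ⟨a, rfl⟩ := φ.surjective ψ
    have h0 : f m = 0 := hm
    exact (hf m a).symm.trans (by rw [h0]; exact comp_zero (X := P) (f := a))
  -- Composition with `y` is a functional on the dual of `M`, so by reflexivity it is evaluation at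
  -- some `m`.
  · let Φ : (M →ₗ[End P] End P) →ₗ[(End P)ᵐᵒᵖ] End P :=
      ((preadditiveCoyonedaObj P).map y).hom ∘ₗ φ.symm.toLinearMap
    obtain ⟨m, hm⟩ := exists_eq_eval hS hT hd M hM Φ
    refine ⟨m, hinj fun c => ?_⟩
    refine (hf m c).trans ((hm (φ c)).symm.trans ?_)
    exact congrArg ((preadditiveCoyonedaObj P).map y).hom (φ.symm_apply_apply c)

end Reflexivity

/-! ### From the exact equivalence to the conditions -/

section Main

variable {E : Type u} [Category.{v} E] [Preadditive E] [HasFiniteBiproducts E]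
  {e : ExactStructure E} {P : E}

theorem IsExactEquivalence.isGPEquivalence
    {h : ∀ X : E, isGP (End P) ((preadditiveCoyonedaObj P).obj X)}
    (he : IsExactEquivalence e (homGP P h)) :
    IsGPEquivalence (preadditiveCoyonedaObj P) ((preadditiveCoyonedaObj P).obj P) := by
  have := he.isEquivalence
  refine ⟨?_, ?_, fun X => (h X).1, fun X => (h X).2, fun M _ _ hf hM => ?_⟩
  · exact inferInstanceAs (homGP P h ⋙ (isGP (End P)).ι).Full
  · exact inferInstanceAs (homGP P h ⋙ (isGP (End P)).ι).Faithful
  · let N : GP (End P) := ⟨ModuleCat.of (End P)ᵐᵒᵖ M, hf, hM⟩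
    exact ⟨(homGP P h).objPreimage N,
      ⟨((isGP (End P)).ι.mapIso ((homGP P h).objObjPreimageIso N)).toLinearEquiv⟩⟩

theorem IsExactEquivalence.satisfiesConditions
    {h : ∀ X : E, isGP (End P) ((preadditiveCoyonedaObj P).obj X)}
    (he : IsExactEquivalence e (homGP P h)) (hR : IsIwanagaGorenstein (End P)) :
    SatisfiesConditions e P := by
  have hG := he.isGPEquivalence
  have H := represents_coyoneda P
  have H' := represents_yoneda P
  have := hR.noetherian.1
  have := hR.noetherian.2
  obtain ⟨d, hd⟩ := extZero_of_injectiveDimension_lt_top (End P) (End P) hR.injdim_left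
  obtain ⟨d', hd'⟩ := extZero_of_injectiveDimension_lt_top (End P)ᵐᵒᵖ (End P) hR.injdim_right
  have hS := bijective_smul_one (End P)
  have hT := bijective_op_smul_one (End P)
  -- Embeddings on one side need finite injective dimension on the other, where the duals live.
  have hB : HasEmbeddings (End P) (End P) := hasEmbeddings hS hT hd'
  have hB' : HasEmbeddings (End P)ᵐᵒᵖ (End P) := hasEmbeddings hT hS hd
  have hc (T : ShortComplex E) := (he.conflation_iff T).trans (GP.conflation_homGP_iff T)
  have hF : e.IsFrobeniusGenerator P := hG.isFrobeniusGenerator H hc hB'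
  have hG' : IsGPEquivalence (preadditiveYonedaObj P)
      ((preadditiveYonedaObj P).obj (Opposite.op P)) :=
    { full := (H'.fullyFaithful hF.op).1
      faithful := (H'.fullyFaithful hF.op).2
      finite := H'.finite_obj hF.op
      extZero := H'.extZero_obj hF.op
      exists_obj := fun M _ _ _ hM => by
        obtain ⟨X, hX⟩ := exists_yoneda_equiv P hG hd' M hM
        exact ⟨.op X, hX⟩ }
  obtain ⟨φ⟩ := H.nonempty_equiv
  obtain ⟨φ'⟩ := H'.nonempty_equiv
  have := Module.Free.of_equiv φ
  have := Module.Free.of_equiv φ'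
  have := hG.finite P
  have := hG'.finite (.op P)
  exact
    { proj_eq_add := fun X => by
        refine ⟨fun hX => ?_, fun hX => (hF.isProj_iff X).2 hX.addIn⟩
        obtain ⟨n, p, hp⟩ := hG.exists_deflation H hc X
        exact isInAdd_of_isProj hX p hp
      noetherian := hR.noetherian
      idempotentComplete := hG.isIdempotentComplete
      frobenius := hF.isFrobenius
      weakKernels := hasWeakKernels_of_exists fun _ _ f => by
        obtain ⟨Z, k, hk, h⟩ := hG.exists_weakKernel hB' hd' f
        exact ⟨Z, k, hk, fun _ => h⟩
      weakCokernels := hasWeakCokernels_of_op <| hasWeakKernels_of_exists fun _ _ f => by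
        obtain ⟨Z, k, hk, h⟩ := hG'.exists_weakKernel hB hd f
        exact ⟨Z, k, hk, fun _ => h⟩
      gldim_lt := hG.gldimMod_lt_top hB' hd'
      gldim_op_lt := hG'.gldimMod_lt_top hB hd }

end Main

end Frob

theorem mainTheorem3 {E : Type u} [Category.{v} E] [Preadditive E] [HasFiniteBiproducts E]
    (e : Frob.ExactStructure E) (P : E) :
    Frob.SatisfiesConditions e P ↔
      (∃ h : ∀ X : E, Frob.isGP (End P) ((preadditiveCoyonedaObj P).obj X),
        Frob.IsExactEquivalence e (Frob.homGP P h)) ∧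
      Frob.IsIwanagaGorenstein (End P) ∧
      Frob.virdim (End P) ≤ (Frob.gldimMod E : WithBot ℕ∞) :=
  ⟨fun h => h.exactEquivalence, fun ⟨⟨_, he⟩, hR, _⟩ => he.satisfiesConditions hR⟩
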